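/- **Setting.** Let $\Sigma$ be a finite alphabet and $\tau\ge 0$ an integer. A two-layer limit transformer $f$ with $H$ heads in its first layer and one head in its second is given by token embeddings $E_s\in\mathbb R^d$ ($s\in\Sigma$), positional embeddings $p_i\in\mathbb R^d$, key, query and value matrices $K_{l,h},Q_{l,h},V_{l,h}$, functions $\phi_{l,h}(j,i)\in\mathbb R$, MLP parameters $A_l,b_l,B_l$ with a $1$-Lipschitz activation $\psi_l$ ($l=1,2$), and an unembedding matrix $U$. At infinite precision, on a nonempty sequence $x$ over $\Sigma$, it computes $y^{(0)}_i=E_{x_i}+p_i$ and, for $l=1,2$ and $1\le i\le |x|$, $$a^{(l,h)}_{i,j}=(y^{(l-1)}_j)^\top K_{l,h}^\top Q_{l,h}\,y^{(l-1)}_i+\log i\cdot\phi_{l,h}(j,i),$$ $$Y^{(l)}_i=y^{(l-1)}_i+\sum_h\frac{\sum_{j=1}^i e^{a^{(l,h)}_{i,j}}V_{l,h}y^{(l-1)}_j}{\sum_{j=1}^i e^{a^{(l,h)}_{i,j}}},\qquad y^{(l)}_i=Y^{(l)}_i+B_l\,\psi_l(A_lY^{(l)}_i+b_l),$$ and its output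 is $f(x)=U y^{(2)}_{|x|}$. The class $\mathcal F_\tau$ consists of those $f$ with $p_i=0$ for all $i$, $\phi_{2,1}=0$, $\|E_s\|\le 1$ for all $s$, and $\phi_{1,h}$ nonnegative, translation invariant ($\phi_{1,h}(j,i)=\phi_{1,h}(j+t,i+t)$) and $\tau$-local ($\phi_{1,h}(j,i)=0$ whenever $i>j+\tau$). For $f\in\mathcal F_\tau$ put $\mathcal P_h=\{\phi_{1,h}(i-t,i):0\le t\le\tau\}\cup\{1\}$ and define the positional margin $$\gamma(f)=\min_{h}\big(\max\mathcal P_h-\max\{p\in\mathcal P_h:p\ne\max\mathcal P_h\}\big),$$ where heads with $\mathcal P_h=\{1\}$ are disregarded and the minimum over an empty set is $+\infty$ (so that $\gamma(f)^{-1}=0$). For polynomials $P,R$ in six variables with nonnegative integer coefficients define the complexity $$C(f)=\exp\Big(P\big(\textstyle\sum_h\|V_{1,h}\|,\ \sum_h\|K_{1,h}^\top Q_{1,h}\|,\ \|A_1\|,\ \|B_1\|,\ \|\psi_1(b_1)\|,\ \|K_{2,1}^\top Q_{2,1}\|\big)\Big)\cdot R\big(\|V_{2,1}\|,\|A_2\|,\|B_2\|,\|U\|,\tau,|\Sigma|\big),$$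 with Euclidean norms of vectors and operator norms of matrices. **Theorem.** There are polynomials $P,R$ and absolute constants $c,M>0$ such that the following holds for every finite alphabet $\Sigma$, every $\tau$, all $f,g\in\mathcal F_\tau$ over $\Sigma$ with the same output dimension (their numbers of heads and embedding dimensions are arbitrary), and every $\varepsilon>0$. There exists an integer $$N\le c\,\max\big(1,\ \max(C(f),C(g))\,\varepsilon^{-1}\big)^{\max(\gamma(f)^{-1},\,\gamma(g)^{-1},\,3)}$$ such that, if $\|f(x)-g(x)\|\le\varepsilon$ for all nonempty sequences $x$ over $\Sigma$ with $|x|\le N$, then $\|f(x)-g(x)\|\le M\varepsilon$ for every nonempty sequence $x$ over $\Sigma$. -/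

import Mathlib

noncomputable section

namespace LimitTransformer

/-- `ℝⁿ` with the Euclidean norm. -/
abbrev Vec (n : ℕ) : Type := EuclideanSpace ℝ (Fin n)

/-- An attention head on `ℝᵈ`: key, query and value matrices (as linear maps), and the function
`φ j i` that modifies the logit between the key position `j` and the query position `i`.
Positions are counted from `1`. -/
structure Head (d : ℕ) where
  keyDim : ℕ
  K : Vec d →L[ℝ] Vec keyDim
  Q : Vec d →L[ℝ] Vec keyDim
  V : Vec d →L[ℝ] Vec d
  φ : ℕ → ℕ → ℝ

/-- The matrix `Kᵀ Q` of a head. -/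
def Head.KQ {d : ℕ} (a : Head d) : Vec d →L[ℝ] Vec d :=
  (ContinuousLinearMap.adjoint a.K).comp a.Q

/-- Infinite-precision logit `yⱼᵀ Kᵀ Q yᵢ + log i * φ(j, i)`. The term `i : Fin T` stands for the
position `i + 1` of the sequence. -/
def Head.logit {d T : ℕ} (a : Head d) (y : Fin T → Vec d) (i j : Fin T) : ℝ :=
  inner ℝ (y j) (a.KQ (y i)) +
    Real.log ((i : ℝ) + 1) * a.φ ((j : ℕ) + 1) ((i : ℕ) + 1)

/-- Output of a head at position `i`: causal softmax attention. -/
def Head.attend {d T : ℕ} (a : Head d) (y : Fin T → Vec d) (i : Fin T) : Vec d :=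
  (∑ j ∈ Finset.Iic i, Real.exp (a.logit y i j))⁻¹ •
    ∑ j ∈ Finset.Iic i, Real.exp (a.logit y i j) • a.V (y j)

/-- A transformer layer on `ℝᵈ` with `H` attention heads, followed by a single-hidden-layer MLP
with a `1`-Lipschitz activation `ψ`. -/
structure Layer (d H : ℕ) where
  head : Fin H → Head d
  width : ℕ
  A : Vec d →L[ℝ] Vec width
  b : Vec width
  ψ : Vec width → Vec width
  ψ_lipschitz : LipschitzWith 1 ψ
  B : Vec width →L[ℝ] Vec d

/-- Pre-activation features: residual connection plus the sum of the heads. -/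
def Layer.pre {d H T : ℕ} (l : Layer d H) (y : Fin T → Vec d) (i : Fin T) : Vec d :=
  y i + ∑ h, (l.head h).attend y i

/-- Post-activation features: residual connection plus the MLP. -/
def Layer.post {d H T : ℕ} (l : Layer d H) (y : Fin T → Vec d) (i : Fin T) : Vec d :=
  l.pre y i + l.B (l.ψ (l.A (l.pre y i) + l.b))

/-- A limit transformer of depth two over the alphabet `α`, with `H` heads in the first layer and
one head in the second, embedding dimension `d` and output dimension `m`. -/
structure TwoLayer (α : Type*) (H d m : ℕ) where
  E : α → Vec d
  pos : ℕ → Vec d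
  layer1 : Layer d H
  layer2 : Layer d 1
  U : Vec d →L[ℝ] Vec m

namespace TwoLayer

variable {α : Type*} {H d m : ℕ}

/-- Token embeddings plus positional embeddings. -/
def embed (f : TwoLayer α H d m) {T : ℕ} (x : Fin T → α) (i : Fin T) : Vec d :=
  f.E (x i) + f.pos ((i : ℕ) + 1)

/-- The output logits at position `i` of the sequence `x`. -/
def outputAt (f : TwoLayer α H d m) {T : ℕ} (x : Fin T → α) (i : Fin T) : Vec m :=
  f.U (f.layer2.post (f.layer1.post (f.embed x)) i)

/-- `f(x)` for a nonempty sequence `x`: the output at the last position. -/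
def eval (f : TwoLayer α H d m) {n : ℕ} (x : Fin (n + 1) → α) : Vec m :=
  f.outputAt x (Fin.last n)

/-- The class of two-layer limit transformers that are `τ`-local and translation invariant, with
nonnegative `φ`, without positional embeddings, without positional information in the second
layer, and with token embeddings of norm at most one. -/
structure MemClass (τ : ℕ) (f : TwoLayer α H d m) : Prop where
  local1 : ∀ h j i, j + τ < i → (f.layer1.head h).φ j i = 0
  translation1 : ∀ h j i t, (f.layer1.head h).φ j i = (f.layer1.head h).φ (j + t) (i + t)
  nonneg1 : ∀ h j i, 0 ≤ (f.layer1.head h).φ j i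
  pos_eq_zero : ∀ i, f.pos i = 0
  layer2_eq_zero : ∀ h j i, (f.layer2.head h).φ j i = 0
  embed_norm : ∀ s, ‖f.E s‖ ≤ 1

/-- The set `{φ(i - t, i) : 0 ≤ t ≤ τ} ∪ {1}` of positional values of the `h`-th head of the first
layer (independent of `i` for a translation-invariant transformer; here `i = t + 1`). -/
def posValues (τ : ℕ) (f : TwoLayer α H d m) (h : Fin H) : Finset ℝ :=
  insert 1 ((Finset.range (τ + 1)).image fun t => (f.layer1.head h).φ 1 (1 + t))

/-- The largest positional value of the `h`-th head. -/
def topValue (τ : ℕ) (f : TwoLayer α H d m) (h : Fin H) : ℝ :=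
  (f.posValues τ h).max' (Finset.insert_nonempty _ _)

/-- The positional margin: the minimum over the heads of the gap between the largest and the second
largest positional value, where the minimum over an empty set is `⊤`. -/
def margin (τ : ℕ) (f : TwoLayer α H d m) : ENNReal :=
  ⨅ h : Fin H, ⨅ p ∈ (f.posValues τ h).filter (fun p => p ≠ f.topValue τ h),
    ENNReal.ofReal (f.topValue τ h - p)

/-- The complexity `exp (P (first-layer norms, ‖Kᵀ Q‖ of the second layer)) * R (other norms, τ, |α|)`
for given polynomials `P` and `R`. The first-layer heads enter through the sums of their norms. -/
def complexity [Fintype α] (P R : MvPolynomial (Fin 6) ℕ) (τ : ℕ) (f : TwoLayer α H d m) : ℝ :=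
  Real.exp (MvPolynomial.aeval
      ![∑ h, ‖(f.layer1.head h).V‖, ∑ h, ‖(f.layer1.head h).KQ‖,
        ‖f.layer1.A‖, ‖f.layer1.B‖, ‖f.layer1.ψ f.layer1.b‖, ‖(f.layer2.head 0).KQ‖] P) *
    MvPolynomial.aeval
      ![‖(f.layer2.head 0).V‖, ‖f.layer2.A‖, ‖f.layer2.B‖, ‖f.U‖,
        (τ : ℝ), (Fintype.card α : ℝ)] R

end TwoLayer

end LimitTransformer

end

noncomputable section

namespace LimitTransformer

open Finset

/-! Every long sequence can be compressed to one of length of order `D ^ e`, where `e` is the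
exponent of the theorem, so that both transformers change their output by at most a stability
constant times `D⁻¹`. With `D` equal to complexity over `ε`, each change is at most `ε`, and
agreement on short sequences gives agreement up to `3 * ε` on all.

Layer one. Adding `log i * φ` to a logit multiplies the attention weight by `i ^ φ`. After division
by `i ^ p`, with `p` the largest positional value, only two contributions survive as `i` grows:
window positions with `φ = p`, and, if `p = 1`, the uniform average over the prefix. The error is `i
^ (-β)` for any `β ≤ 1` not exceeding the positional margin (`PosGap.norm_posSum_sub_le`). Hence the
hidden vector at a position is nearly determined by the last `τ + 1` tokens and the token
frequencies of the prefix (`TwoLayer.hidden_sub_le`).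

Layer two. Without positional terms its output at the last position depends only on the hidden
vector there and on averages over all positions of the attention weight and of the weighted hidden
vector (`Head.attendNat_sub_le_of_avg`).

Compression. Cut the sequence into `n` strata, keep one cyclic window of length `l` from each, and
append the last `τ + 1` tokens. Token indicators, and the second-layer features of both transformers
computed on the long sequence, form one Hilbert-space-valued sequence. A greedy choice of windows
keeps its deviations after `m` blocks of size `√m` (`exists_sample`), so prefix frequencies and
global averages survive. Contiguity of a window preserves local contexts except near block starts
and wrap-arounds. These positions and the first block, where frequencies are uncontrolled, make up a
small fraction and are bounded trivially (`Compression.sum_hidden_sub_le`). The choice `n ≈ D ^ 2`,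
`l ≈ D ^ (e - 2)`, `β = e⁻¹` makes all errors of order `D⁻¹`. -/

theorem sum_inv_sqrt_le (n : ℕ) :
    ∑ i ∈ range n, (√((i : ℝ) + 1))⁻¹ ≤ 2 * √(n : ℝ) := by
  induction n with
  | zero => simp
  | succ n ih =>
    rw [sum_range_succ]
    push_cast
    have ha : 0 < √((n : ℝ) + 1) := Real.sqrt_pos.2 (by positivity)
    have hb : 0 ≤ √(n : ℝ) := Real.sqrt_nonneg _
    have hsa : √((n : ℝ) + 1) ^ 2 = n + 1 := Real.sq_sqrt (by positivity)
    have hsb : √(n : ℝ) ^ 2 = n := Real.sq_sqrt (by positivity)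
    have : (√((n : ℝ) + 1))⁻¹ ≤ 2 * √((n : ℝ) + 1) - 2 * √(n : ℝ) := by
      rw [inv_le_iff_one_le_mul₀ ha]
      nlinarith [sq_nonneg (√((n : ℝ) + 1) - √(n : ℝ))]
    linarith

/-- Since `n / t ≥ 1`, its power `β` is at most its square root. This reduces sums of `t ^ (-β)` to
the case of exponent one half, with a constant that does not depend on `β`. -/
theorem rpow_neg_le_mul_inv_sqrt {β t n : ℝ} (hβ : β ≤ 1 / 2) (ht : 0 < t) (htn : t ≤ n) :
    t ^ (-β) ≤ n ^ (-β) * (√n * (√t)⁻¹) := by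
  have hn : 0 < n := ht.trans_le htn
  have h1 : (n / t) ^ β ≤ (n / t) ^ (1 / 2 : ℝ) :=
    Real.rpow_le_rpow_of_exponent_le ((one_le_div ht).2 htn) hβ
  rw [← Real.sqrt_eq_rpow, Real.sqrt_div hn.le, Real.div_rpow hn.le ht.le] at h1
  have h2 : 0 < n ^ β := Real.rpow_pos_of_pos hn _
  rw [Real.rpow_neg hn.le, Real.rpow_neg ht.le, ← div_eq_mul_inv]
  calc (t ^ β)⁻¹ = (n ^ β)⁻¹ * (n ^ β / t ^ β) := by field_simp
    _ ≤ _ := by gcongr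

theorem sum_rpow_neg_le {β : ℝ} (hβ : β ≤ 1 / 2) (n : ℕ) :
    ∑ i ∈ range n, ((i : ℝ) + 1) ^ (-β) ≤ 2 * n * (n : ℝ) ^ (-β) := by
  calc ∑ i ∈ range n, ((i : ℝ) + 1) ^ (-β)
      ≤ ∑ i ∈ range n, (n : ℝ) ^ (-β) * (√n * (√((i : ℝ) + 1))⁻¹) := by
        refine sum_le_sum fun i hi => rpow_neg_le_mul_inv_sqrt hβ (by positivity) ?_
        have := mem_range.1 hi
        exact_mod_cast this
    _ = (n : ℝ) ^ (-β) * (√n * ∑ i ∈ range n, (√((i : ℝ) + 1))⁻¹) := by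
        rw [mul_sum, mul_sum]
    _ ≤ (n : ℝ) ^ (-β) * (√n * (2 * √(n : ℝ))) := by
        gcongr
        exact sum_inv_sqrt_le n
    _ = 2 * n * (n : ℝ) ^ (-β) := by
        rw [show √(n : ℝ) * (2 * √(n : ℝ)) = 2 * (√(n : ℝ) * √(n : ℝ)) by ring,
          Real.mul_self_sqrt (by positivity)]
        ring

theorem sum_range_mul {M : Type*} [AddCommMonoid M] (F : ℕ → M) (n l : ℕ) :
    ∑ i ∈ range (n * l), F i = ∑ m ∈ range n, ∑ r ∈ range l, F (m * l + r) := by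
  induction n with
  | zero => simp
  | succ n ih => rw [sum_range_succ, ← ih, Nat.succ_mul, sum_range_add]

/-- Rotation permutes the residues modulo `L`. This is the reason for cyclic windows: averaged over
all starting points, the window mean is exactly the stratum mean. -/
theorem sum_range_add_mod {M : Type*} [AddCommMonoid M] (F : ℕ → M) {L : ℕ} (r : ℕ) :
    ∑ s ∈ range L, F ((s + r) % L) = ∑ s ∈ range L, F s := by
  have h : ∑ s ∈ range L, F ((s + r) % L) = ∑ s ∈ Ico r (r + L), F (s % L) := by
    rw [range_eq_Ico, sum_Ico_add' (fun s => F (s % L)) 0 L r, zero_add, add_comm L r]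
  have him := Nat.image_Ico_mod r L
  rw [h, ← him, sum_image]
  -- Reduction modulo `L` maps an interval of `L` integers onto `L` residues, so it is injective
  -- there.
  apply Finset.injOn_of_card_image_eq
  rw [him]
  simp

/-- Two ratios `B⁻¹ A` of a vector-valued and a scalar sum are close when the sums are. -/
theorem norm_inv_smul_sub_le {F : Type*} [NormedAddCommGroup F] [NormedSpace ℝ F]
    {A A' : F} {B B' c : ℝ} (hB : 0 < B) (hB' : 0 < B') (hA : ‖A‖ ≤ c * B) :
    ‖B⁻¹ • A - B'⁻¹ • A'‖ ≤ B'⁻¹ * (‖A - A'‖ + c * |B - B'|) := by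
  have h : B⁻¹ • A - B'⁻¹ • A' = B'⁻¹ • ((A - A') - (B - B') • (B⁻¹ • A)) := by
    have : (B - B') • (B⁻¹ • A) = A - (B' * B⁻¹) • A := by
      rw [sub_smul, smul_smul, smul_smul, mul_inv_cancel₀ hB.ne', one_smul]
    rw [this, sub_sub_sub_cancel_left, smul_sub, smul_smul, ← mul_assoc,
      inv_mul_cancel₀ hB'.ne', one_mul]
  have hA' : ‖B⁻¹ • A‖ ≤ c := by
    rw [norm_smul, Real.norm_eq_abs, abs_of_pos (by positivity), inv_mul_le_iff₀ hB, mul_comm]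
    exact hA
  rw [h, norm_smul, Real.norm_eq_abs, abs_of_pos (inv_pos.2 hB')]
  gcongr
  refine (norm_sub_le _ _).trans ?_
  rw [norm_smul, Real.norm_eq_abs, mul_comm c]
  gcongr

theorem norm_sum_smul_le {ι F : Type*} [NormedAddCommGroup F] [NormedSpace ℝ F] {s : Finset ι}
    {w : ι → ℝ} {v : ι → F} {c : ℝ} (hw : ∀ i ∈ s, 0 ≤ w i) (hv : ∀ i ∈ s, ‖v i‖ ≤ c) :
    ‖∑ i ∈ s, w i • v i‖ ≤ c * ∑ i ∈ s, w i := by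
  rw [mul_sum]
  refine norm_sum_le_of_le _ fun i hi => ?_
  rw [norm_smul, Real.norm_eq_abs, abs_of_nonneg (hw i hi), mul_comm]
  gcongr
  · exact hw i hi
  · exact hv i hi

theorem norm_inv_smul_sum_le {F : Type*} [NormedAddCommGroup F] [NormedSpace ℝ F] {v : ℕ → F}
    {c : ℝ} (hv : ∀ i, ‖v i‖ ≤ c) {n : ℕ} (hn : 0 < n) (u : ℕ → ℕ) :
    ‖(n : ℝ)⁻¹ • ∑ i ∈ range n, v (u i)‖ ≤ c := by
  rw [norm_smul, norm_inv, Real.norm_natCast, inv_mul_le_iff₀ (by positivity)]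
  simpa using norm_sum_le_of_le (range n) fun i _ => hv (u i)

/-! ### Derandomized stratified sampling -/

/-- The position that is read at time `i` when block `m` (of length `l`) is a cyclic window of the
`m`-th stratum (of length `L`), starting at its element number `s m`. -/
def samplePos (L l : ℕ) (s : ℕ → ℕ) (i : ℕ) : ℕ :=
  i / l * L + (s (i / l) + i % l) % L

theorem samplePos_mul_add {L l : ℕ} (s : ℕ → ℕ) (m : ℕ) {r : ℕ} (hr : r < l) :
    samplePos L l s (m * l + r) = m * L + (s m + r) % L := by
  have hl : 0 < l := by omega
  have h1 : (m * l + r) / l = m := by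
    rw [mul_comm, Nat.mul_add_div hl, Nat.div_eq_of_lt hr, add_zero]
  have h2 : (m * l + r) % l = r := by
    rw [mul_comm, Nat.mul_add_mod, Nat.mod_eq_of_lt hr]
  rw [samplePos, h1, h2]

/-- Greedy derandomization of stratified sampling in a Hilbert space: one can choose the windows
such that all partial sums of the deviations are of square-root size. -/
theorem exists_sample {E : Type*} [NormedAddCommGroup E] [InnerProductSpace ℝ E]
    (Φ : ℕ → E) {ρ : ℝ} (hΦ : ∀ i, ‖Φ i‖ ≤ ρ) {L l : ℕ} (hL : 0 < L) (hl : 0 < l) :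
    ∃ s : ℕ → ℕ, ∀ m : ℕ,
      ‖(l : ℝ)⁻¹ • ∑ i ∈ range (m * l), Φ (samplePos L l s i)
        - (L : ℝ)⁻¹ • ∑ i ∈ range (m * L), Φ i‖ ≤ 2 * ρ * √(m : ℝ) := by
  have hρ : 0 ≤ ρ := (norm_nonneg _).trans (hΦ 0)
  let u : ℕ → ℕ → E := fun m s => (l : ℝ)⁻¹ • ∑ r ∈ range l, Φ (m * L + (s + r) % L)
    - (L : ℝ)⁻¹ • ∑ r ∈ range L, Φ (m * L + r)
  have hu : ∀ m s, ‖u m s‖ ≤ 2 * ρ := fun m s => by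
    refine (norm_sub_le _ _).trans ?_
    rw [two_mul]
    exact add_le_add (norm_inv_smul_sum_le hΦ hl _) (norm_inv_smul_sum_le hΦ hL _)
  have hsum : ∀ m, ∑ s ∈ range L, u m s = 0 := fun m => by
    have hl' : (l : ℝ) ≠ 0 := by positivity
    have hL' : (L : ℝ) ≠ 0 := by positivity
    simp only [u]
    rw [sum_sub_distrib, ← smul_sum, sum_comm]
    simp only [sum_range_add_mod (fun j => Φ (m * L + j))]
    simp only [sum_const, card_range, ← Nat.cast_smul_eq_nsmul ℝ, smul_smul]
    rw [inv_mul_cancel₀ hl', mul_inv_cancel₀ hL', sub_self]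
  -- Over the `L` starting points the deviations sum to zero, so their inner products with a fixed
  -- vector cannot all be positive.
  have hpick : ∀ (m : ℕ) (S : E), ∃ s, inner ℝ S (u m s) ≤ 0 := fun m S => by
    obtain ⟨s, -, hs⟩ := exists_le_of_sum_le (s := range L) (f := fun s => inner ℝ S (u m s))
      (g := fun _ => (0 : ℝ)) ⟨0, mem_range.2 hL⟩ (by rw [← inner_sum, hsum]; simp)
    exact ⟨s, hs⟩
  choose pick hpick using hpick
  let S : ℕ → E := fun m => Nat.rec 0 (fun k S => S + u k (pick k S)) m
  have hS : ∀ m, S (m + 1) = S m + u m (pick m (S m)) := fun m => rfl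
  have hSnorm : ∀ m : ℕ, ‖S m‖ ≤ 2 * ρ * √(m : ℝ) := by
    intro m
    apply le_of_sq_le_sq _ (by positivity)
    rw [mul_pow, Real.sq_sqrt (by positivity)]
    induction m with
    | zero => simp [S]
    | succ m ih =>
      -- The cross term is nonpositive by the choice of window, so each block adds at most `(2 * ρ)
      -- ^ 2` to the squared norm.
      rw [hS, norm_add_sq_real]
      have h1 := hpick m (S m)
      have h2 : ‖u m (pick m (S m))‖ ^ 2 ≤ (2 * ρ) ^ 2 := by
        gcongr
        exact hu _ _
      push_cast
      linarith
  refine ⟨fun m => pick m (S m), fun m => ?_⟩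
  convert hSnorm m using 2
  induction m with
  | zero => simp [S]
  | succ m ih =>
    have hb : ∑ r ∈ range l, Φ (samplePos L l (fun m => pick m (S m)) (m * l + r))
        = ∑ r ∈ range l, Φ (m * L + (pick m (S m) + r) % L) :=
      sum_congr rfl fun r hr => by rw [samplePos_mul_add _ _ (mem_range.1 hr)]
    rw [hS, Nat.succ_mul, Nat.succ_mul, sum_range_add, sum_range_add, hb]
    simp only [u, smul_add]
    linear_combination (norm := module) ih

/-! ### Sequences indexed by natural numbers -/

section Nat

variable {d H : ℕ}

/-- `Head.attend` for an infinite sequence of activations. -/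
def Head.attendNat (a : Head d) (y : ℕ → Vec d) (i : ℕ) : Vec d :=
  (∑ j ∈ range (i + 1),
      Real.exp (inner ℝ (y j) (a.KQ (y i)) + Real.log ((i : ℝ) + 1) * a.φ (j + 1) (i + 1)))⁻¹ •
    ∑ j ∈ range (i + 1),
      Real.exp (inner ℝ (y j) (a.KQ (y i)) + Real.log ((i : ℝ) + 1) * a.φ (j + 1) (i + 1)) •
        a.V (y j)

/-- `Layer.pre` for an infinite sequence of activations. -/
def Layer.preNat (l : Layer d H) (y : ℕ → Vec d) (i : ℕ) : Vec d :=
  y i + ∑ h, (l.head h).attendNat y i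

/-- The residual connection plus the MLP of a layer. -/
def Layer.mlp (l : Layer d H) (z : Vec d) : Vec d :=
  z + l.B (l.ψ (l.A z + l.b))

/-- `Layer.post` for an infinite sequence of activations. -/
def Layer.postNat (l : Layer d H) (y : ℕ → Vec d) (i : ℕ) : Vec d :=
  l.mlp (l.preNat y i)

theorem sum_Iic_fin {M : Type*} [AddCommMonoid M] {T : ℕ} (F : ℕ → M) (i : Fin T) :
    ∑ j ∈ Finset.Iic i, F j = ∑ j ∈ range ((i : ℕ) + 1), F j := by
  rw [Nat.range_succ_eq_Iic, ← Fin.map_valEmbedding_Iic, sum_map]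
  rfl

theorem Head.attend_eq (a : Head d) {T : ℕ} (y : ℕ → Vec d) (i : Fin T) :
    a.attend (fun j : Fin T => y j) i = a.attendNat y i := by
  unfold Head.attend Head.attendNat Head.logit
  rw [← sum_Iic_fin, ← sum_Iic_fin (fun j => Real.exp (inner ℝ (y j) (a.KQ (y i)) +
    Real.log ((i : ℝ) + 1) * a.φ (j + 1) (i + 1)) • a.V (y j))]

theorem Layer.post_eq (l : Layer d H) {T : ℕ} (y : ℕ → Vec d) (i : Fin T) :
    l.post (fun j : Fin T => y j) i = l.postNat y i := by
  unfold Layer.post Layer.postNat Layer.mlp Layer.pre Layer.preNat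
  simp only [Head.attend_eq]

theorem Layer.mlp_sub_le (l : Layer d H) (z z' : Vec d) :
    ‖l.mlp z - l.mlp z'‖ ≤ (1 + ‖l.B‖ * ‖l.A‖) * ‖z - z'‖ := by
  have h : l.mlp z - l.mlp z'
      = (z - z') + l.B (l.ψ (l.A z + l.b) - l.ψ (l.A z' + l.b)) := by
    unfold Layer.mlp
    rw [map_sub]
    abel
  rw [h, add_mul, one_mul, mul_assoc]
  refine (norm_add_le _ _).trans (add_le_add le_rfl ?_)
  refine (l.B.le_opNorm _).trans ?_
  gcongr
  have := l.ψ_lipschitz.norm_sub_le (l.A z + l.b) (l.A z' + l.b)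
  rw [add_sub_add_right_eq_sub, ← map_sub] at this
  simpa using this.trans (mul_le_mul_of_nonneg_left (l.A.le_opNorm _) (by simp))

theorem Layer.norm_mlp_le (l : Layer d H) (z : Vec d) :
    ‖l.mlp z‖ ≤ (1 + ‖l.B‖ * ‖l.A‖) * ‖z‖ + ‖l.B‖ * ‖l.ψ l.b‖ := by
  have h0 : ‖l.mlp 0‖ ≤ ‖l.B‖ * ‖l.ψ l.b‖ := by
    simpa [Layer.mlp] using l.B.le_opNorm (l.ψ l.b)
  have h1 := l.mlp_sub_le z 0
  rw [sub_zero] at h1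
  calc ‖l.mlp z‖ = ‖(l.mlp z - l.mlp 0) + l.mlp 0‖ := by rw [sub_add_cancel]
    _ ≤ _ := (norm_add_le _ _).trans (add_le_add h1 h0)

theorem Head.norm_attendNat_le (a : Head d) {y : ℕ → Vec d} {r : ℝ} (hy : ∀ i, ‖y i‖ ≤ r)
    (i : ℕ) : ‖a.attendNat y i‖ ≤ ‖a.V‖ * r := by
  unfold Head.attendNat
  have hpos : 0 < ∑ j ∈ range (i + 1), Real.exp (inner ℝ (y j) (a.KQ (y i)) +
      Real.log ((i : ℝ) + 1) * a.φ (j + 1) (i + 1)) :=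
    sum_pos (fun _ _ => Real.exp_pos _) (by simp)
  rw [norm_smul, norm_inv, Real.norm_eq_abs, abs_of_pos hpos, inv_mul_le_iff₀ hpos, mul_comm]
  refine norm_sum_smul_le (fun j _ => (Real.exp_pos _).le) fun j _ => ?_
  refine (a.V.le_opNorm _).trans ?_
  gcongr
  exact hy j

end Nat

namespace TwoLayer

variable {α : Type*} {H d m : ℕ}

/-- First-layer output on an infinite sequence of tokens. -/
def hidden (f : TwoLayer α H d m) (X : ℕ → α) (i : ℕ) : Vec d :=
  f.layer1.postNat (fun j => f.E (X j)) i

/-- Output at position `n` on an infinite sequence of tokens. -/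
def evalNat (f : TwoLayer α H d m) (X : ℕ → α) (n : ℕ) : Vec m :=
  f.U (f.layer2.postNat (f.hidden X) n)

/-- Attention is causal, so tokens beyond position `n` are irrelevant. Infinite sequences can
therefore replace finite ones, and compression becomes composition with a map on `ℕ`. -/
theorem eval_eq {τ : ℕ} {f : TwoLayer α H d m} (hf : f.MemClass τ) (X : ℕ → α) (n : ℕ) :
    f.eval (fun i : Fin (n + 1) => X i) = f.evalNat X n := by
  unfold eval outputAt evalNat
  have h0 : f.embed (fun i : Fin (n + 1) => X i) = fun i : Fin (n + 1) => f.E (X i) := by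
    funext i
    simp [embed, hf.pos_eq_zero]
  have h1 : f.layer1.post (fun i : Fin (n + 1) => f.E (X i))
      = fun i : Fin (n + 1) => f.hidden X i := by
    funext i
    exact f.layer1.post_eq (fun j => f.E (X j)) i
  rw [h0, h1, Layer.post_eq]
  simp

/-- A bound for the norm of the output of the first layer. -/
def radius (f : TwoLayer α H d m) : ℝ :=
  (1 + ∑ h, ‖(f.layer1.head h).V‖) * (1 + ‖f.layer1.B‖ * ‖f.layer1.A‖)
    + ‖f.layer1.B‖ * ‖f.layer1.ψ f.layer1.b‖

theorem one_le_radius (f : TwoLayer α H d m) : 1 ≤ f.radius := by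
  have h1 : 0 ≤ ∑ h, ‖(f.layer1.head h).V‖ := sum_nonneg fun _ _ => norm_nonneg _
  have h2 : 0 ≤ ‖f.layer1.B‖ * ‖f.layer1.A‖ := by positivity
  have h3 : 0 ≤ ‖f.layer1.B‖ * ‖f.layer1.ψ f.layer1.b‖ := by positivity
  unfold radius
  nlinarith [mul_nonneg h1 h2]

theorem norm_hidden_le {τ : ℕ} {f : TwoLayer α H d m} (hf : f.MemClass τ) (X : ℕ → α) (i : ℕ) :
    ‖f.hidden X i‖ ≤ f.radius := by
  refine (f.layer1.norm_mlp_le _).trans ?_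
  unfold radius
  rw [mul_comm (1 + ∑ h, _)]
  gcongr
  refine (norm_add_le _ _).trans (add_le_add (hf.embed_norm _) ?_)
  refine norm_sum_le_of_le _ fun h _ => ?_
  simpa using (f.layer1.head h).norm_attendNat_le (fun j => hf.embed_norm (X j)) i

end TwoLayer

/-! ### The first layer for long sequences -/

section Positional

variable {α : Type*} {F : Type*} [NormedAddCommGroup F] [NormedSpace ℝ F]

/-- Relative frequency of `s` among the first `i + 1` tokens. -/
def freq [DecidableEq α] (X : ℕ → α) (i : ℕ) (s : α) : ℝ :=
  ((i : ℝ) + 1)⁻¹ * ∑ j ∈ range (i + 1), if X j = s then 1 else 0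

theorem inv_smul_sum_eq_sum_freq [DecidableEq α] [Fintype α] (X : ℕ → α) (u : α → F) (i : ℕ) :
    ((i : ℝ) + 1)⁻¹ • ∑ j ∈ range (i + 1), u (X j) = ∑ s, freq X i s • u s := by
  simp only [freq, mul_smul, sum_smul, ite_smul, one_smul, zero_smul]
  rw [← smul_sum, sum_comm]
  simp

/-- Sum over the positions `j ≤ i`, weighted by powers of the length. -/
def posSum (φ : ℕ → ℕ → ℝ) (p : ℝ) (X : ℕ → α) (u : α → F) (i : ℕ) : F :=
  ∑ j ∈ range (i + 1), ((i : ℝ) + 1) ^ (φ (j + 1) (i + 1) - p) • u (X j)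

/-- The limit of `posSum` for long sequences. -/
def posLimit (τ : ℕ) (φ : ℕ → ℕ → ℝ) (p : ℝ) (X : ℕ → α) (u : α → F) (i : ℕ) : F :=
  ∑ t ∈ range (τ + 1), (if φ 1 (1 + t) = p then (1 : ℝ) else 0) • u (X (i - t))
    + (if p = 1 then (1 : ℝ) else 0) • (((i : ℝ) + 1)⁻¹ • ∑ j ∈ range (i + 1), u (X j))

/-- Numerators of attention are dominated by `‖V‖` times the denominators, which is the hypothesis
`hA` of `norm_inv_smul_sub_le`. The next lemma does the same for the limits. -/
theorem norm_posSum_le (φ : ℕ → ℕ → ℝ) (p : ℝ) (X : ℕ → α) {u : α → F} {g : α → ℝ} {c : ℝ}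
    (h : ∀ s, ‖u s‖ ≤ c * g s) (i : ℕ) :
    ‖posSum φ p X u i‖ ≤ c * posSum φ p X g i := by
  unfold posSum
  rw [mul_sum]
  refine norm_sum_le_of_le _ fun j _ => ?_
  have hw : 0 ≤ ((i : ℝ) + 1) ^ (φ (j + 1) (i + 1) - p) := by positivity
  rw [norm_smul, Real.norm_eq_abs, abs_of_nonneg hw, smul_eq_mul, mul_left_comm]
  gcongr
  exact h _

theorem norm_posLimit_le (τ : ℕ) (φ : ℕ → ℕ → ℝ) (p : ℝ) (X : ℕ → α) {u : α → F} {g : α → ℝ}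
    {c : ℝ} (h : ∀ s, ‖u s‖ ≤ c * g s) (i : ℕ) :
    ‖posLimit τ φ p X u i‖ ≤ c * posLimit τ φ p X g i := by
  unfold posLimit
  rw [mul_add, mul_sum]
  refine (norm_add_le _ _).trans (add_le_add (norm_sum_le_of_le _ fun t _ => ?_) ?_)
  · split_ifs
    · simpa using h _
    · simp
  · split_ifs
    · simp only [one_smul, smul_eq_mul, one_mul]
      have hsum : ‖∑ j ∈ range (i + 1), u (X j)‖ ≤ c * ∑ j ∈ range (i + 1), g (X j) := by
        rw [mul_sum]
        exact norm_sum_le_of_le _ fun j _ => h _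
      have hI : 0 ≤ ((i : ℝ) + 1)⁻¹ := by positivity
      rw [norm_smul, Real.norm_of_nonneg hI, mul_left_comm]
      exact mul_le_mul_of_nonneg_left hsum hI
    · simp

/-- The window sums coincide term by term, and the uniform average is a combination of the `u s`
with the frequencies as coefficients. -/
theorem posLimit_sub_le [DecidableEq α] [Fintype α] (τ : ℕ) (φ : ℕ → ℕ → ℝ) (p : ℝ)
    {X X' : ℕ → α} {u : α → F} {c η : ℝ} (hu : ∀ s, ‖u s‖ ≤ c) {i i' : ℕ}
    (hwin : ∀ t ≤ τ, X (i - t) = X' (i' - t)) (hη : ∀ s, |freq X i s - freq X' i' s| ≤ η) :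
    ‖posLimit τ φ p X u i - posLimit τ φ p X' u i'‖ ≤ Fintype.card α * η * c := by
  have hw : ∑ t ∈ range (τ + 1), (if φ 1 (1 + t) = p then (1 : ℝ) else 0) • u (X (i - t))
      = ∑ t ∈ range (τ + 1), (if φ 1 (1 + t) = p then (1 : ℝ) else 0) • u (X' (i' - t)) :=
    sum_congr rfl fun t ht => by rw [hwin t (by simpa [Nat.lt_succ_iff] using ht)]
  have hd : ‖∑ s, freq X i s • u s - ∑ s, freq X' i' s • u s‖ ≤ Fintype.card α * η * c := by
    rw [← sum_sub_distrib]
    refine (norm_sum_le_of_le univ (f := fun s => freq X i s • u s - freq X' i' s • u s)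
      (n := fun _ => η * c) fun s _ => ?_).trans (by simp [mul_assoc])
    rw [← sub_smul, norm_smul]
    exact mul_le_mul (hη s) (hu s) (norm_nonneg _) ((abs_nonneg _).trans (hη s))
  unfold posLimit
  rw [hw, add_sub_add_left_eq_sub, inv_smul_sum_eq_sum_freq, inv_smul_sum_eq_sum_freq, ← smul_sub]
  split_ifs
  · rwa [one_smul]
  · rw [zero_smul, norm_zero]
    exact (norm_nonneg _).trans hd

theorem sum_range_eq_far_add_window {M : Type*} [AddCommMonoid M] (G : ℕ → M) {τ i : ℕ}
    (h : τ ≤ i) :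
    ∑ j ∈ range (i + 1), G j = ∑ j ∈ range (i - τ), G j + ∑ t ∈ range (τ + 1), G (i - t) := by
  obtain ⟨k, rfl⟩ := Nat.exists_eq_add_of_le' h
  rw [Nat.add_sub_cancel, add_assoc, sum_range_add]
  congr 1
  rw [← sum_range_reflect]
  refine sum_congr rfl fun t ht => ?_
  congr 1
  have := mem_range.1 ht
  omega

/-- The data of a head that enter the rate of convergence: `p` is the largest positional value,
and `β` a lower bound for its distance to the others. -/
structure PosGap (τ : ℕ) (φ : ℕ → ℕ → ℝ) (p β : ℝ) : Prop where
  loc : ∀ j i, j + τ < i → φ j i = 0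
  trans : ∀ j t, φ (j + 1) (j + t + 1) = φ 1 (1 + t)
  one_or_le : p = 1 ∨ 1 + β ≤ p
  eq_or_le : ∀ t ≤ τ, φ 1 (1 + t) = p ∨ φ 1 (1 + t) + β ≤ p
  attained : p = 1 ∨ ∃ t ≤ τ, φ 1 (1 + t) = p
  beta_le : β ≤ 1

/-- In the window, `φ = p` gives weight one and any other value gives at most `(i + 1) ^ (-β)`. Far
positions have `φ = 0` and weight `(i + 1) ^ (-p)`. If `p = 1`, they form the uniform average up to
the `τ + 1` window terms; otherwise `p ≥ 1 + β`, and even `i + 1` of them contribute at most order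
`(i + 1) ^ (-β)`. The competition with the uniform mass of the far positions is why `1` counts as a
positional value. -/
theorem PosGap.norm_posSum_sub_le {τ : ℕ} {φ : ℕ → ℕ → ℝ} {p β : ℝ} (hg : PosGap τ φ p β)
    (X : ℕ → α) {u : α → F} {c : ℝ} (hu : ∀ s, ‖u s‖ ≤ c) (hc : 0 ≤ c) {i : ℕ} (hi : τ ≤ i) :
    ‖posSum φ p X u i - posLimit τ φ p X u i‖ ≤ 2 * (τ + 1) * c * ((i : ℝ) + 1) ^ (-β) := by
  have hI : (1 : ℝ) ≤ (i : ℝ) + 1 := by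
    have : (0 : ℝ) ≤ i := by positivity
    linarith
  have hI0 : (0 : ℝ) < (i : ℝ) + 1 := by linarith
  set P : ℝ := ((i : ℝ) + 1) ^ (-β) with hP
  have hP0 : 0 ≤ P := by positivity
  have hsplit : posSum φ p X u i = ∑ j ∈ range (i - τ), ((i : ℝ) + 1) ^ (-p) • u (X j)
      + ∑ t ∈ range (τ + 1), ((i : ℝ) + 1) ^ (φ 1 (1 + t) - p) • u (X (i - t)) := by
    unfold posSum
    rw [sum_range_eq_far_add_window _ hi]
    congr 1
    · refine sum_congr rfl fun j hj => ?_
      have := mem_range.1 hj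
      rw [hg.loc _ _ (by omega), zero_sub]
    · refine sum_congr rfl fun t ht => ?_
      have := mem_range.1 ht
      have h := hg.trans (i - t) t
      rw [Nat.sub_add_cancel (by omega)] at h
      rw [h]
  have hwindow : ‖∑ t ∈ range (τ + 1), ((i : ℝ) + 1) ^ (φ 1 (1 + t) - p) • u (X (i - t))
      - ∑ t ∈ range (τ + 1), (if φ 1 (1 + t) = p then (1 : ℝ) else 0) • u (X (i - t))‖
      ≤ (τ + 1) * c * P := by
    rw [← sum_sub_distrib]
    refine (norm_sum_le_of_le (n := fun _ => c * P) _ fun t ht => ?_).trans (by simp [mul_assoc])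
    rw [← sub_smul, norm_smul, mul_comm]
    refine mul_le_mul (hu _) ?_ (norm_nonneg _) hc
    rcases hg.eq_or_le t (by simpa [Nat.lt_succ_iff] using ht) with h | h
    · simpa [h] using hP0
    · split_ifs with h'
      · simpa [h'] using hP0
      · rw [sub_zero, Real.norm_of_nonneg (by positivity)]
        exact Real.rpow_le_rpow_of_exponent_le hI (by linarith)
  have hfar : ‖∑ j ∈ range (i - τ), ((i : ℝ) + 1) ^ (-p) • u (X j)
      - (if p = 1 then (1 : ℝ) else 0) • (((i : ℝ) + 1)⁻¹ • ∑ j ∈ range (i + 1), u (X j))‖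
      ≤ (τ + 1) * c * P := by
    by_cases hp : p = 1
    · have hPinv : ((i : ℝ) + 1)⁻¹ ≤ P := by
        rw [← Real.rpow_neg_one]
        exact Real.rpow_le_rpow_of_exponent_le hI (by linarith [hg.beta_le])
      rw [if_pos hp, hp, Real.rpow_neg_one, one_smul, ← smul_sum, ← smul_sub,
        sum_range_eq_far_add_window _ hi, sub_add_cancel_left, norm_smul, norm_neg,
        Real.norm_of_nonneg (by positivity), mul_comm]
      refine mul_le_mul ?_ hPinv (by positivity) (by positivity)
      exact (norm_sum_le_of_le _ fun t _ => hu _).trans (by simp)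
    · have hle : 1 + β ≤ p := hg.one_or_le.resolve_left hp
      rw [if_neg hp, zero_smul, sub_zero]
      have h1 : ‖∑ j ∈ range (i - τ), ((i : ℝ) + 1) ^ (-p) • u (X j)‖
          ≤ ((i - τ : ℕ) : ℝ) * (((i : ℝ) + 1) ^ (-p) * c) := by
        refine (norm_sum_le_of_le (n := fun _ => ((i : ℝ) + 1) ^ (-p) * c) _
          fun j _ => ?_).trans (by simp)
        rw [norm_smul, Real.norm_of_nonneg (by positivity)]
        gcongr
        exact hu _
      have h2 : ((i - τ : ℕ) : ℝ) ≤ (i : ℝ) + 1 := by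
        have : i - τ ≤ i + 1 := by omega
        exact_mod_cast this
      have h3 : ((i : ℝ) + 1) * ((i : ℝ) + 1) ^ (-p) ≤ P := by
        rw [mul_comm, ← Real.rpow_add_one hI0.ne']
        exact Real.rpow_le_rpow_of_exponent_le hI (by linarith)
      calc _ ≤ _ := h1
        _ ≤ ((i : ℝ) + 1) * (((i : ℝ) + 1) ^ (-p) * c) := by gcongr
        _ = (((i : ℝ) + 1) * ((i : ℝ) + 1) ^ (-p)) * c := by ring
        _ ≤ P * c := by gcongr
        _ = 1 * c * P := by ring
        _ ≤ (τ + 1) * c * P := by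
          gcongr
          have : (0 : ℝ) ≤ τ := by positivity
          linarith
  rw [hsplit, posLimit, add_comm (∑ j ∈ range (i - τ), _), add_sub_add_comm]
  refine (norm_add_le _ _).trans ((add_le_add hwindow hfar).trans (le_of_eq (by ring)))

/-- The value `p` is attained, either by `1` or at a window position, so the limit contains at least
one of these with full weight. This bounds the limiting softmax denominator away from zero,
uniformly in the length. -/
theorem PosGap.le_posLimit {τ : ℕ} {φ : ℕ → ℕ → ℝ} {p β : ℝ} (hg : PosGap τ φ p β)
    (X : ℕ → α) {g : α → ℝ} {c : ℝ} (hgc : ∀ s, c ≤ g s) (hc : 0 ≤ c) (i : ℕ) :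
    c ≤ posLimit τ φ p X g i := by
  have hg0 : ∀ s, 0 ≤ g s := fun s => hc.trans (hgc s)
  have hterm : ∀ t, 0 ≤ (if φ 1 (1 + t) = p then (1 : ℝ) else 0) • g (X (i - t)) := fun t => by
    split_ifs
    · simpa using hg0 _
    · simp
  have h1 : 0 ≤ ∑ t ∈ range (τ + 1), (if φ 1 (1 + t) = p then (1 : ℝ) else 0) • g (X (i - t)) :=
    sum_nonneg fun t _ => hterm t
  have h2 : c ≤ ((i : ℝ) + 1)⁻¹ • ∑ j ∈ range (i + 1), g (X j) := by
    rw [smul_eq_mul, le_inv_mul_iff₀ (by positivity)]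
    have := card_nsmul_le_sum (range (i + 1)) (fun j => g (X j)) c fun j _ => hgc _
    simpa using this
  unfold posLimit
  rcases hg.attained with h | ⟨t, ht, h⟩
  · rw [if_pos h, one_smul]
    linarith
  · have h3 := single_le_sum (f := fun t => (if φ 1 (1 + t) = p then (1 : ℝ) else 0) •
      g (X (i - t))) (fun t _ => hterm t) (mem_range.2 (Nat.lt_succ_iff.2 ht))
    simp only [if_pos h, one_smul] at h3
    have h4 : 0 ≤ (if p = 1 then (1 : ℝ) else 0) •
        (((i : ℝ) + 1)⁻¹ • ∑ j ∈ range (i + 1), g (X j)) := by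
      split_ifs
      · rw [one_smul]
        exact hc.trans h2
      · simp
    have := hgc (X (i - t))
    linarith

/-- The common factor `(i + 1) ^ p` cancels between numerator and denominator. -/
theorem Head.attendNat_eq {d : ℕ} (a : Head d) (p : ℝ) (E : α → Vec d) (X : ℕ → α) (i : ℕ) :
    a.attendNat (fun j => E (X j)) i =
      (posSum a.φ p X (fun s => Real.exp (inner ℝ (E s) (a.KQ (E (X i))))) i)⁻¹ •
        posSum a.φ p X (fun s => Real.exp (inner ℝ (E s) (a.KQ (E (X i)))) • a.V (E s)) i := by
  have hI0 : (0 : ℝ) < (i : ℝ) + 1 := by positivity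
  have hw : ∀ j, Real.exp (inner ℝ (E (X j)) (a.KQ (E (X i))) +
      Real.log ((i : ℝ) + 1) * a.φ (j + 1) (i + 1)) = ((i : ℝ) + 1) ^ p *
        (((i : ℝ) + 1) ^ (a.φ (j + 1) (i + 1) - p) *
          Real.exp (inner ℝ (E (X j)) (a.KQ (E (X i))))) := fun j => by
    rw [← mul_assoc, ← Real.rpow_add hI0, add_sub_cancel, Real.exp_add,
      Real.rpow_def_of_pos hI0, mul_comm]
  have hp : ((i : ℝ) + 1) ^ p ≠ 0 := (Real.rpow_pos_of_pos hI0 _).ne'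
  unfold Head.attendNat posSum
  simp only [hw, smul_eq_mul, smul_smul]
  simp only [← mul_sum, mul_smul (((i : ℝ) + 1) ^ p), ← smul_sum]
  rw [smul_smul, mul_inv, mul_right_comm, inv_mul_cancel₀ hp, one_mul]

/-- Both attention outputs are replaced by the ratios of their limits, at cost `(i + 1) ^ (-β)` and
`(i' + 1) ^ (-β)`; the two limits are compared through windows and frequencies. -/
theorem Head.attendNat_sub_le [DecidableEq α] [Fintype α] {d τ : ℕ} {a : Head d} {p β : ℝ}
    (hg : PosGap τ a.φ p β) {E : α → Vec d} (hE : ∀ s, ‖E s‖ ≤ 1) {X X' : ℕ → α} {η : ℝ}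
    {i i' : ℕ} (hi : τ ≤ i) (hi' : τ ≤ i') (hwin : ∀ t ≤ τ, X (i - t) = X' (i' - t))
    (hη : ∀ s, |freq X i s - freq X' i' s| ≤ η) :
    ‖a.attendNat (fun j => E (X j)) i - a.attendNat (fun j => E (X' j)) i'‖ ≤
      ‖a.V‖ * Real.exp (2 * ‖a.KQ‖) *
        (4 * (τ + 1) * (((i : ℝ) + 1) ^ (-β) + ((i' : ℝ) + 1) ^ (-β))
          + 2 * (Fintype.card α * η)) := by
  -- The case `t = 0` of the window condition: the query tokens agree, so the same functions `g` and
  -- `u` of the key token serve both sequences.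
  have hX : X i = X' i' := by simpa using hwin 0 (Nat.zero_le _)
  rw [a.attendNat_eq p, a.attendNat_eq p, ← hX]
  set k := ‖a.KQ‖
  set g : α → ℝ := fun s => Real.exp (inner ℝ (E s) (a.KQ (E (X i))))
  set u : α → Vec d := fun s => g s • a.V (E s)
  have hinner : ∀ s, |inner ℝ (E s) (a.KQ (E (X i)))| ≤ k := fun s => by
    refine (abs_real_inner_le_norm _ _).trans ?_
    have := a.KQ.le_opNorm (E (X i))
    have h1 : ‖a.KQ (E (X i))‖ ≤ k := this.trans (mul_le_of_le_one_right (norm_nonneg _) (hE _))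
    exact (mul_le_of_le_one_left (norm_nonneg _) (hE s)).trans h1
  have hg0 : ∀ s, 0 < g s := fun s => Real.exp_pos _
  have hglo : ∀ s, Real.exp (-k) ≤ g s := fun s => Real.exp_le_exp.2 (abs_le.1 (hinner s)).1
  have hghi : ∀ s, g s ≤ Real.exp k := fun s => Real.exp_le_exp.2 (abs_le.1 (hinner s)).2
  have hgn : ∀ s, ‖g s‖ ≤ Real.exp k := fun s => by
    rw [Real.norm_of_nonneg (hg0 s).le]
    exact hghi s
  have hug : ∀ s, ‖u s‖ ≤ ‖a.V‖ * g s := fun s => by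
    rw [norm_smul, Real.norm_of_nonneg (hg0 s).le, mul_comm]
    gcongr
    exact (a.V.le_opNorm _).trans (mul_le_of_le_one_right (norm_nonneg _) (hE _))
  have hun : ∀ s, ‖u s‖ ≤ ‖a.V‖ * Real.exp k := fun s => (hug s).trans (by gcongr; exact hghi s)
  have hS : ∀ (X : ℕ → α) (i : ℕ), 0 < posSum a.φ p X g i := fun X i =>
    sum_pos (fun j _ => by
      have : (0 : ℝ) < (i : ℝ) + 1 := by positivity
      have := hg0 (X j)
      positivity) (by simp)
  have hLlo : ∀ (X : ℕ → α) (i : ℕ), Real.exp (-k) ≤ posLimit τ a.φ p X g i := fun X i =>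
    hg.le_posLimit X hglo (Real.exp_pos _).le i
  have hL : ∀ (X : ℕ → α) (i : ℕ), 0 < posLimit τ a.φ p X g i := fun X i =>
    (Real.exp_pos _).trans_le (hLlo X i)
  have hLinv : ∀ (X : ℕ → α) (i : ℕ), (posLimit τ a.φ p X g i)⁻¹ ≤ Real.exp k := fun X i => by
    rw [← inv_inv (Real.exp k), ← Real.exp_neg]
    exact inv_anti₀ (Real.exp_pos _) (hLlo X i)
  have hexp : Real.exp (2 * k) = Real.exp k * Real.exp k := by rw [← Real.exp_add, two_mul]
  have hstep : ∀ (X : ℕ → α) (i : ℕ), τ ≤ i →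
      ‖(posSum a.φ p X g i)⁻¹ • posSum a.φ p X u i
        - (posLimit τ a.φ p X g i)⁻¹ • posLimit τ a.φ p X u i‖
      ≤ ‖a.V‖ * Real.exp (2 * k) * (4 * (τ + 1) * ((i : ℝ) + 1) ^ (-β)) := fun X i hi => by
    refine (norm_inv_smul_sub_le (hS X i) (hL X i) (norm_posSum_le _ _ _ hug i)).trans ?_
    calc _ ≤ Real.exp k * (2 * (τ + 1) * (‖a.V‖ * Real.exp k) * ((i : ℝ) + 1) ^ (-β)
          + ‖a.V‖ * (2 * (τ + 1) * Real.exp k * ((i : ℝ) + 1) ^ (-β))) := by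
          gcongr
          · exact hLinv X i
          · exact hg.norm_posSum_sub_le X hun (by positivity) hi
          · exact hg.norm_posSum_sub_le X hgn (by positivity) hi
      _ = _ := by rw [hexp]; ring
  have hmid : ‖(posLimit τ a.φ p X g i)⁻¹ • posLimit τ a.φ p X u i
        - (posLimit τ a.φ p X' g i')⁻¹ • posLimit τ a.φ p X' u i'‖
      ≤ ‖a.V‖ * Real.exp (2 * k) * (2 * (Fintype.card α * η)) := by
    refine (norm_inv_smul_sub_le (hL X i) (hL X' i') (norm_posLimit_le _ _ _ _ hug i)).trans ?_
    calc _ ≤ Real.exp k * (Fintype.card α * η * (‖a.V‖ * Real.exp k)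
          + ‖a.V‖ * (Fintype.card α * η * Real.exp k)) := by
          gcongr
          · exact hLinv X' i'
          · exact posLimit_sub_le τ a.φ p hun hwin hη
          · exact posLimit_sub_le τ a.φ p hgn hwin hη
      _ = _ := by rw [hexp]; ring
  have h1 := hstep X i hi
  have h2 := hstep X' i' hi'
  rw [norm_sub_rev] at h2
  calc _ ≤ _ := norm_sub_le_norm_sub_add_norm_sub _
            ((posLimit τ a.φ p X g i)⁻¹ • posLimit τ a.φ p X u i) _
    _ ≤ _ := add_le_add le_rfl (norm_sub_le_norm_sub_add_norm_sub _
            ((posLimit τ a.φ p X' g i')⁻¹ • posLimit τ a.φ p X' u i') _)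
    _ ≤ _ := add_le_add h1 (add_le_add hmid h2)
    _ = _ := by ring

theorem TwoLayer.hidden_sub_le [DecidableEq α] [Fintype α] {H d m τ : ℕ} {f : TwoLayer α H d m}
    (hf : f.MemClass τ) {β : ℝ} (hg : ∀ h, ∃ p, PosGap τ (f.layer1.head h).φ p β)
    {X X' : ℕ → α} {η : ℝ} (hη0 : 0 ≤ η)
    {i i' : ℕ} (hi : τ ≤ i) (hi' : τ ≤ i') (hwin : ∀ t ≤ τ, X (i - t) = X' (i' - t))
    (hη : ∀ s, |freq X i s - freq X' i' s| ≤ η) :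
    ‖f.hidden X i - f.hidden X' i'‖ ≤
      f.radius * Real.exp (2 * ∑ h, ‖(f.layer1.head h).KQ‖) *
        (4 * (τ + 1) * (((i : ℝ) + 1) ^ (-β) + ((i' : ℝ) + 1) ^ (-β))
          + 2 * (Fintype.card α * η)) := by
  have hX : X i = X' i' := by simpa using hwin 0 (Nat.zero_le _)
  set Q : ℝ := 4 * (τ + 1) * (((i : ℝ) + 1) ^ (-β) + ((i' : ℝ) + 1) ^ (-β))
          + 2 * (Fintype.card α * η)
  have hQ : 0 ≤ Q := by positivity
  set k := ∑ h, ‖(f.layer1.head h).KQ‖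
  have hpre : ‖f.layer1.preNat (fun j => f.E (X j)) i - f.layer1.preNat (fun j => f.E (X' j)) i'‖
      ≤ (∑ h, ‖(f.layer1.head h).V‖) * (Real.exp (2 * k) * Q) := by
    simp only [Layer.preNat]
    rw [hX, add_sub_add_left_eq_sub, ← sum_sub_distrib, sum_mul]
    refine norm_sum_le_of_le _ fun h _ => ?_
    obtain ⟨p, hp⟩ := hg h
    refine (Head.attendNat_sub_le hp hf.embed_norm hi hi' hwin hη).trans ?_
    rw [mul_assoc]
    gcongr
    exact single_le_sum (f := fun h => ‖(f.layer1.head h).KQ‖) (fun _ _ => norm_nonneg _)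
      (mem_univ h)
  refine (f.layer1.mlp_sub_le _ _).trans ?_
  calc _ ≤ (1 + ‖f.layer1.B‖ * ‖f.layer1.A‖) *
        ((∑ h, ‖(f.layer1.head h).V‖) * (Real.exp (2 * k) * Q)) := by gcongr
    _ = ((∑ h, ‖(f.layer1.head h).V‖) * (1 + ‖f.layer1.B‖ * ‖f.layer1.A‖)) *
        (Real.exp (2 * k) * Q) := by ring
    _ ≤ f.radius * (Real.exp (2 * k) * Q) := by
      gcongr
      unfold TwoLayer.radius
      have h1 : 0 ≤ ‖f.layer1.B‖ * ‖f.layer1.A‖ := by positivity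
      have h2 : 0 ≤ ‖f.layer1.B‖ * ‖f.layer1.ψ f.layer1.b‖ := by positivity
      linarith
    _ = _ := by ring

end Positional

/-! ### The second layer -/

theorem abs_exp_sub_exp_le {a b k : ℝ} (ha : a ≤ k) (hb : b ≤ k) :
    |Real.exp a - Real.exp b| ≤ Real.exp k * |a - b| := by
  have key : ∀ {a b : ℝ}, a ≤ k → b ≤ a → Real.exp a - Real.exp b ≤ Real.exp k * (a - b) := by
    intro a b ha hba
    have h1 := Real.add_one_le_exp (b - a)
    have h2 : Real.exp b = Real.exp a * Real.exp (b - a) := by rw [← Real.exp_add]; congr 1; ring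
    have h3 := Real.exp_le_exp.2 ha
    have h4 := Real.exp_pos a
    rw [h2]
    nlinarith
  rcases le_total b a with h | h
  · rw [abs_of_nonneg (sub_nonneg.2 (Real.exp_le_exp.2 h)), abs_of_nonneg (sub_nonneg.2 h)]
    exact key ha h
  · rw [abs_sub_comm, abs_sub_comm a, abs_of_nonneg (sub_nonneg.2 (Real.exp_le_exp.2 h)),
      abs_of_nonneg (sub_nonneg.2 h)]
    exact key hb h

section SecondLayer

variable {d : ℕ}

/-- Unnormalized attention weight, without positional information, of position `i` for the last
position `n`. -/
def Head.weight (a : Head d) (y : ℕ → Vec d) (n i : ℕ) : ℝ :=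
  Real.exp (inner ℝ (y i) (a.KQ (y n)))

theorem Head.attendNat_eq_avg (a : Head d) (hφ : ∀ j i, a.φ j i = 0) (y : ℕ → Vec d) (n : ℕ) :
    a.attendNat y n = (((n + 1 : ℕ) : ℝ)⁻¹ • ∑ i ∈ range (n + 1), a.weight y n i)⁻¹ •
      (((n + 1 : ℕ) : ℝ)⁻¹ • ∑ i ∈ range (n + 1), a.weight y n i • a.V (y i)) := by
  have hn : ((n + 1 : ℕ) : ℝ) ≠ 0 := by positivity
  unfold Head.attendNat Head.weight
  simp only [hφ, mul_zero, add_zero]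
  rw [smul_smul, smul_eq_mul, mul_inv, inv_inv, mul_right_comm, mul_inv_cancel₀ hn, one_mul]

theorem Head.abs_inner_le (a : Head d) {r : ℝ} {u v : Vec d} (hu : ‖u‖ ≤ r) (hv : ‖v‖ ≤ r) :
    |inner ℝ u (a.KQ v)| ≤ ‖a.KQ‖ * r ^ 2 := by
  have hr : 0 ≤ r := (norm_nonneg _).trans hu
  calc _ ≤ ‖u‖ * ‖a.KQ v‖ := abs_real_inner_le_norm _ _
    _ ≤ r * (‖a.KQ‖ * r) := by
      gcongr
      exact (a.KQ.le_opNorm _).trans (by gcongr)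
    _ = _ := by ring

/-- The comparison passes through the averages of `y` along the sampled positions `u i`. From the
full averages to these is sampling error (`hw`, `hwy`); from these to the averages of `y'` is
Lipschitz dependence on keys (`havg`) and on the query (`hlast`). -/
theorem Head.attendNat_sub_le_of_avg (a : Head d) (hφ : ∀ j i, a.φ j i = 0) {r δ : ℝ}
    (hr : 1 ≤ r) {y y' : ℕ → Vec d} (hy : ∀ i, ‖y i‖ ≤ r) (hy' : ∀ i, ‖y' i‖ ≤ r) {n n' : ℕ}
    (u : ℕ → ℕ)
    (havg : ((n' + 1 : ℕ) : ℝ)⁻¹ * ∑ i ∈ range (n' + 1), ‖y (u i) - y' i‖ ≤ δ)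
    (hlast : ‖y n - y' n'‖ ≤ δ)
    (hw : |((n + 1 : ℕ) : ℝ)⁻¹ • ∑ i ∈ range (n + 1), a.weight y n i
      - ((n' + 1 : ℕ) : ℝ)⁻¹ • ∑ i ∈ range (n' + 1), a.weight y n (u i)|
        ≤ Real.exp (‖a.KQ‖ * r ^ 2) * δ)
    (hwy : ‖((n + 1 : ℕ) : ℝ)⁻¹ • ∑ i ∈ range (n + 1), a.weight y n i • y i
      - ((n' + 1 : ℕ) : ℝ)⁻¹ • ∑ i ∈ range (n' + 1), a.weight y n (u i) • y (u i)‖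
        ≤ Real.exp (‖a.KQ‖ * r ^ 2) * (r * δ)) :
    ‖a.attendNat y n - a.attendNat y' n'‖ ≤
      ‖a.V‖ * Real.exp (2 * (‖a.KQ‖ * r ^ 2)) * ((4 * (‖a.KQ‖ * r ^ 2) + 2 * r + 1) * δ) := by
  have hr0 : 0 < r := by linarith
  have hδ : 0 ≤ δ := (norm_nonneg _).trans hlast
  set q := ‖a.KQ‖ with hq
  have hq0 : 0 ≤ q := norm_nonneg _
  set κ := q * r ^ 2 with hκ
  have hlo : ∀ (y : ℕ → Vec d), (∀ i, ‖y i‖ ≤ r) → ∀ n i, Real.exp (-κ) ≤ a.weight y n i :=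
    fun y hy n i => Real.exp_le_exp.2 (abs_le.1 (a.abs_inner_le (hy i) (hy n))).1
  have hhi : ∀ (y : ℕ → Vec d), (∀ i, ‖y i‖ ≤ r) → ∀ n i, a.weight y n i ≤ Real.exp κ :=
    fun y hy n i => Real.exp_le_exp.2 (abs_le.1 (a.abs_inner_le (hy i) (hy n))).2
  have hpos : ∀ (y : ℕ → Vec d) n i, 0 < a.weight y n i := fun y n i => Real.exp_pos _
  have hdiff : ∀ i, |a.weight y n (u i) - a.weight y' n' i|
      ≤ Real.exp κ * (q * r * (‖y (u i) - y' i‖ + δ)) := fun i => by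
    refine (abs_exp_sub_exp_le (abs_le.1 (a.abs_inner_le (hy (u i)) (hy n))).2
      (abs_le.1 (a.abs_inner_le (hy' i) (hy' n'))).2).trans ?_
    gcongr
    have heq : inner ℝ (y (u i)) (a.KQ (y n)) - inner ℝ (y' i) (a.KQ (y' n'))
        = inner ℝ (y (u i) - y' i) (a.KQ (y n)) + inner ℝ (y' i) (a.KQ (y n - y' n')) := by
      rw [inner_sub_left, map_sub, inner_sub_right]
      ring
    rw [heq]
    calc _ ≤ _ := abs_add_le _ _
      _ ≤ ‖y (u i) - y' i‖ * (q * r) + r * (q * δ) := by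
        gcongr
        · refine (abs_real_inner_le_norm _ _).trans ?_
          gcongr
          exact (a.KQ.le_opNorm _).trans (by gcongr; exact hy n)
        · refine (abs_real_inner_le_norm _ _).trans ?_
          gcongr
          · exact hy' i
          · exact (a.KQ.le_opNorm _).trans (by gcongr)
      _ = _ := by ring
  set c : ℝ := ((n' + 1 : ℕ) : ℝ)⁻¹ with hc
  have hc0 : 0 ≤ c := by positivity
  have hcn : c * (n' + 1 : ℕ) = 1 := inv_mul_cancel₀ (by positivity)
  have hB : |c • ∑ i ∈ range (n' + 1), a.weight y n (u i)
      - c • ∑ i ∈ range (n' + 1), a.weight y' n' i| ≤ Real.exp κ * (2 * q * r * δ) := by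
    rw [← smul_sub, ← sum_sub_distrib, smul_eq_mul, abs_mul, abs_of_nonneg hc0]
    calc _ ≤ c * ∑ i ∈ range (n' + 1), Real.exp κ * (q * r * (‖y (u i) - y' i‖ + δ)) := by
          gcongr
          exact (abs_sum_le_sum_abs _ _).trans (sum_le_sum fun i _ => hdiff i)
      _ = Real.exp κ * (q * r * (c * ∑ i ∈ range (n' + 1), ‖y (u i) - y' i‖
          + c * (n' + 1 : ℕ) * δ)) := by
          rw [← mul_sum, ← mul_sum, sum_add_distrib, sum_const, card_range, nsmul_eq_mul]
          ring
      _ ≤ Real.exp κ * (q * r * (δ + 1 * δ)) := by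
          rw [hcn]
          gcongr
      _ = _ := by ring
  have hA : ‖c • ∑ i ∈ range (n' + 1), a.weight y n (u i) • y (u i)
      - c • ∑ i ∈ range (n' + 1), a.weight y' n' i • y' i‖
        ≤ Real.exp κ * ((2 * κ + 1) * δ) := by
    rw [← smul_sub, ← sum_sub_distrib, norm_smul, Real.norm_of_nonneg hc0]
    have hterm : ∀ i, ‖a.weight y n (u i) • y (u i) - a.weight y' n' i • y' i‖
        ≤ Real.exp κ * ‖y (u i) - y' i‖ + Real.exp κ * (q * r * (‖y (u i) - y' i‖ + δ)) * r := by
      intro i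
      have heq : a.weight y n (u i) • y (u i) - a.weight y' n' i • y' i
          = a.weight y n (u i) • (y (u i) - y' i)
            + (a.weight y n (u i) - a.weight y' n' i) • y' i := by
        rw [smul_sub, sub_smul]
        abel
      rw [heq]
      refine (norm_add_le _ _).trans (add_le_add ?_ ?_)
      · rw [norm_smul, Real.norm_of_nonneg (hpos _ _ _).le]
        gcongr
        exact hhi y hy _ _
      · rw [norm_smul, Real.norm_eq_abs]
        gcongr
        · exact hdiff i
        · exact hy' i
    calc _ ≤ c * ∑ i ∈ range (n' + 1), (Real.exp κ * ‖y (u i) - y' i‖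
            + Real.exp κ * (q * r * (‖y (u i) - y' i‖ + δ)) * r) := by
          gcongr
          exact norm_sum_le_of_le _ fun i _ => hterm i
      _ = Real.exp κ * ((c * ∑ i ∈ range (n' + 1), ‖y (u i) - y' i‖)
          + κ * (c * ∑ i ∈ range (n' + 1), ‖y (u i) - y' i‖ + c * (n' + 1 : ℕ) * δ)) := by
          rw [sum_add_distrib, ← sum_mul, ← mul_sum, ← mul_sum, ← mul_sum, sum_add_distrib,
            sum_const, card_range, nsmul_eq_mul, hκ]
          ring
      _ ≤ Real.exp κ * (δ + κ * (δ + 1 * δ)) := by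
          rw [hcn]
          gcongr
      _ = _ := by ring
  have havgpos : ∀ (y : ℕ → Vec d), (∀ i, ‖y i‖ ≤ r) → ∀ n : ℕ, Real.exp (-κ) ≤
      ((n + 1 : ℕ) : ℝ)⁻¹ • ∑ i ∈ range (n + 1), a.weight y n i := fun y hy n => by
    rw [smul_eq_mul, le_inv_mul_iff₀ (by positivity)]
    have := card_nsmul_le_sum (range (n + 1)) (fun i => a.weight y n i) _ fun i _ => hlo y hy n i
    simpa using this
  -- Since `V` is linear it can be pulled out of the average, so the sampled features need not
  -- involve it.
  have hAV : ∀ (y : ℕ → Vec d) (n : ℕ),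
      ((n + 1 : ℕ) : ℝ)⁻¹ • ∑ i ∈ range (n + 1), a.weight y n i • a.V (y i)
        = a.V (((n + 1 : ℕ) : ℝ)⁻¹ • ∑ i ∈ range (n + 1), a.weight y n i • y i) := fun y n => by
    rw [map_smul, map_sum]
    simp only [map_smul]
  rw [a.attendNat_eq_avg hφ, a.attendNat_eq_avg hφ, hAV, hAV, ← map_smul, ← map_smul, ← map_sub,
    mul_assoc]
  refine (a.V.le_opNorm _).trans ?_
  gcongr
  refine (norm_inv_smul_sub_le (c := r) ((Real.exp_pos _).trans_le (havgpos y hy n))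
    ((Real.exp_pos _).trans_le (havgpos y' hy' n')) ?_).trans ?_
  · rw [norm_smul, Real.norm_of_nonneg (by positivity), smul_eq_mul, mul_left_comm]
    gcongr
    exact norm_sum_smul_le (fun i _ => (hpos _ _ _).le) fun i _ => hy i
  · have hinv : (((n' + 1 : ℕ) : ℝ)⁻¹ • ∑ i ∈ range (n' + 1), a.weight y' n' i)⁻¹
        ≤ Real.exp κ := by
      rw [← inv_inv (Real.exp κ), ← Real.exp_neg]
      exact inv_anti₀ (Real.exp_pos _) (havgpos y' hy' n')
    have hA' := (norm_sub_le_norm_sub_add_norm_sub _ _ _).trans (add_le_add hwy hA)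
    have hB' := (abs_sub_le _ _ _).trans (add_le_add hw hB)
    have hexp : Real.exp (2 * κ) = Real.exp κ * Real.exp κ := by rw [← Real.exp_add, two_mul]
    calc _ ≤ Real.exp κ * ((Real.exp κ * (r * δ) + Real.exp κ * ((2 * κ + 1) * δ))
          + r * (Real.exp κ * δ + Real.exp κ * (2 * q * r * δ))) := by gcongr
      _ = _ := by rw [hexp, hκ]; ring

end SecondLayer

/-! ### The positional margin -/

namespace TwoLayer

variable {α : Type*} {H d m : ℕ}

theorem le_topValue {τ : ℕ} (f : TwoLayer α H d m) (h : Fin H) {q : ℝ}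
    (hq : q ∈ f.posValues τ h) : q ≤ f.topValue τ h :=
  le_max' _ _ hq

/-- Finitely many positive gaps have a positive lower bound. Positivity matters because `toReal`
sends `⊤` to `0`: a vanishing margin would otherwise yield exponent zero. -/
theorem margin_pos (τ : ℕ) (f : TwoLayer α H d m) : 0 < f.margin τ := by
  have key : ∀ h : Fin H, ∃ b : ℝ, 0 < b ∧
      ∀ q ∈ (f.posValues τ h).filter (fun p => p ≠ f.topValue τ h), b ≤ f.topValue τ h - q := by
    intro h
    rcases ((f.posValues τ h).filter (fun p => p ≠ f.topValue τ h)).eq_empty_or_nonempty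
      with h0 | h0
    · exact ⟨1, one_pos, by simp [h0]⟩
    · obtain ⟨q, hq, hmin⟩ := exists_min_image _ (fun q => f.topValue τ h - q) h0
      rw [mem_filter] at hq
      exact ⟨_, sub_pos.2 (lt_of_le_of_ne (f.le_topValue h hq.1) hq.2), hmin⟩
  choose b hb0 hb using key
  obtain ⟨c, hc0, hc⟩ : ∃ c : ℝ, 0 < c ∧ ∀ h, c ≤ b h := by
    rcases isEmpty_or_nonempty (Fin H) with hH | hH
    · exact ⟨1, one_pos, fun h => hH.elim h⟩
    · obtain ⟨h, hh⟩ := Finite.exists_min b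
      exact ⟨b h, hb0 h, hh⟩
  refine (ENNReal.ofReal_pos.2 hc0).trans_le ?_
  exact le_iInf fun h => le_iInf₂ fun q hq =>
    ENNReal.ofReal_le_ofReal ((hc h).trans (hb h q hq))

theorem ofReal_inv_le_margin {τ : ℕ} {f : TwoLayer α H d m} {e : ℝ} (he : 0 < e)
    (h : ((f.margin τ)⁻¹).toReal ≤ e) : ENNReal.ofReal e⁻¹ ≤ f.margin τ := by
  have hne : (f.margin τ)⁻¹ ≠ ⊤ := ENNReal.inv_ne_top.2 (f.margin_pos τ).ne'
  rw [ENNReal.ofReal_inv_of_pos he, ENNReal.inv_le_iff_inv_le]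
  exact (ENNReal.le_ofReal_iff_toReal_le hne he.le).2 h

theorem MemClass.posGap {τ : ℕ} {f : TwoLayer α H d m} (hf : f.MemClass τ) {β : ℝ} (hβ : β ≤ 1)
    (hm : ENNReal.ofReal β ≤ f.margin τ) (h : Fin H) :
    PosGap τ (f.layer1.head h).φ (f.topValue τ h) β := by
  have key : ∀ q ∈ f.posValues τ h, q = f.topValue τ h ∨ q + β ≤ f.topValue τ h := by
    intro q hq
    by_cases hqt : q = f.topValue τ h
    · exact Or.inl hqt
    · right
      have h1 : ENNReal.ofReal β ≤ ENNReal.ofReal (f.topValue τ h - q) :=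
        hm.trans ((iInf_le _ h).trans (iInf₂_le q (mem_filter.2 ⟨hq, hqt⟩)))
      have h2 := (ENNReal.ofReal_le_ofReal_iff (sub_nonneg.2 (f.le_topValue h hq))).1 h1
      linarith
  have hmem : ∀ t ≤ τ, (f.layer1.head h).φ 1 (1 + t) ∈ f.posValues τ h := fun t ht =>
    mem_insert_of_mem (mem_image_of_mem _ (mem_range.2 (Nat.lt_succ_iff.2 ht)))
  refine ⟨hf.local1 h, fun j t => ?_, ?_, fun t ht => key _ (hmem t ht), ?_, hβ⟩
  · rw [hf.translation1 h 1 (1 + t) j]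
    congr 1 <;> omega
  · exact (key 1 (mem_insert_self _ _)).imp Eq.symm id
  · have := max'_mem (f.posValues τ h) (insert_nonempty _ _)
    rcases mem_insert.1 this with h1 | h1
    · exact Or.inl h1
    · obtain ⟨t, ht, h2⟩ := mem_image.1 h1
      exact Or.inr ⟨t, Nat.lt_succ_iff.1 (mem_range.1 ht), h2⟩

end TwoLayer

/-! ### Averages over the sampled sequence -/

section Sampling

/-- The difference is the sum over the `k` new terms of their deviations from the old mean, divided
by `M + k`. -/
theorem norm_avg_prefix_sub_le {F : Type*} [NormedAddCommGroup F] [NormedSpace ℝ F] {v : ℕ → F}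
    {c : ℝ} (hv : ∀ i, ‖v i‖ ≤ c) {M : ℕ} (hM : 0 < M) (k : ℕ) :
    ‖((M + k : ℕ) : ℝ)⁻¹ • ∑ i ∈ range (M + k), v i - (M : ℝ)⁻¹ • ∑ i ∈ range M, v i‖
      ≤ 2 * c * (k / M) := by
  have hc : 0 ≤ c := (norm_nonneg _).trans (hv 0)
  have hM0 : (0 : ℝ) < M := by exact_mod_cast hM
  have hMk : (0 : ℝ) < ((M + k : ℕ) : ℝ) := by positivity
  set a : F := (M : ℝ)⁻¹ • ∑ i ∈ range M, v i with ha
  have han : ‖a‖ ≤ c := norm_inv_smul_sum_le hv hM id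
  have hS : ∑ i ∈ range M, v i = (M : ℝ) • a := by
    rw [ha, smul_smul, mul_inv_cancel₀ hM0.ne', one_smul]
  have heq : ((M + k : ℕ) : ℝ)⁻¹ • ∑ i ∈ range (M + k), v i - a
      = ((M + k : ℕ) : ℝ)⁻¹ • (∑ i ∈ range k, v (M + i) - (k : ℝ) • a) := by
    have h1 : a = ((M + k : ℕ) : ℝ)⁻¹ • (((M + k : ℕ) : ℝ) • a) := by
      rw [smul_smul, inv_mul_cancel₀ hMk.ne', one_smul]
    nth_rw 1 [h1]
    rw [← smul_sub, sum_range_add, hS]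
    congr 1
    push_cast
    module
  rw [heq, norm_smul, norm_inv, Real.norm_natCast, inv_mul_le_iff₀ hMk]
  have h2 : ‖∑ i ∈ range k, v (M + i) - (k : ℝ) • a‖ ≤ 2 * c * k := by
    refine (norm_sub_le _ _).trans ?_
    have h3 : ‖∑ i ∈ range k, v (M + i)‖ ≤ k * c := by
      simpa using norm_sum_le_of_le (range k) fun i _ => hv (M + i)
    have h4 : ‖(k : ℝ) • a‖ ≤ k * c := by
      rw [norm_smul, Real.norm_natCast]
      gcongr
    linarith
  refine h2.trans ?_
  have h5 : (M : ℝ) ≤ ((M + k : ℕ) : ℝ) := by exact_mod_cast Nat.le_add_right M k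
  calc 2 * c * k = M * (2 * c * (k / M)) := by field_simp
    _ ≤ _ := by gcongr

/-- The block sums of `v` along the sample follow its stratum sums up to square-root errors. -/
def SampleClose {F : Type*} [NormedAddCommGroup F] [NormedSpace ℝ F] (L l : ℕ) (s : ℕ → ℕ)
    (b : ℝ) (v : ℕ → F) : Prop :=
  ∀ m : ℕ, ‖(l : ℝ)⁻¹ • ∑ i ∈ range (m * l), v (samplePos L l s i)
    - (L : ℝ)⁻¹ • ∑ i ∈ range (m * L), v i‖ ≤ b * √(m : ℝ)

variable {E F : Type*} [NormedAddCommGroup E] [NormedSpace ℝ E] [NormedAddCommGroup F]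
  [NormedSpace ℝ F] {L l : ℕ} {s : ℕ → ℕ} {b : ℝ}

/-- Lets one sample of a direct sum serve all its components at once. -/
theorem SampleClose.map {v : ℕ → E} (h : SampleClose L l s b v) (p : E →ₗ[ℝ] F)
    (hp : ∀ x, ‖p x‖ ≤ ‖x‖) : SampleClose L l s b (fun i => p (v i)) := fun m => by
  refine le_trans ?_ (h m)
  rw [← map_sum, ← map_sum, ← map_smul, ← map_smul, ← map_sub]
  exact hp _

theorem SampleClose.smul {v : ℕ → E} (h : SampleClose L l s b v) {c : ℝ} (hc : 0 ≤ c) :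
    SampleClose L l s (c * b) (fun i => c • v i) := fun m => by
  rw [← smul_sum, ← smul_sum, smul_comm _ c, smul_comm _ c, ← smul_sub, norm_smul,
    Real.norm_of_nonneg hc, mul_assoc]
  gcongr
  exact h m

/-- The averages over `m` full strata and `m` full blocks differ by `b * √m / m`; the two incomplete
ends are absorbed by `norm_avg_prefix_sub_le`. -/
theorem SampleClose.avg_sub_le {v : ℕ → F} (h : SampleClose L l s b v) {c : ℝ}
    (hv : ∀ i, ‖v i‖ ≤ c) (hL : 0 < L) (hl : 0 < l) {m : ℕ} (hm : 0 < m) {u : ℕ → ℕ}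
    (hu : ∀ i < m * l, u i = samplePos L l s i) (k k' : ℕ) :
    ‖((m * L + k : ℕ) : ℝ)⁻¹ • ∑ i ∈ range (m * L + k), v i
      - ((m * l + k' : ℕ) : ℝ)⁻¹ • ∑ i ∈ range (m * l + k'), v (u i)‖
      ≤ 2 * c * (k / (m * L)) + 2 * c * (k' / (m * l)) + b / √(m : ℝ) := by
  have h1 := norm_avg_prefix_sub_le hv (Nat.mul_pos hm hL) k
  have h2 := norm_avg_prefix_sub_le (fun i => hv (u i)) (Nat.mul_pos hm hl) k'
  have h3 : ‖((m * L : ℕ) : ℝ)⁻¹ • ∑ i ∈ range (m * L), v i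
      - ((m * l : ℕ) : ℝ)⁻¹ • ∑ i ∈ range (m * l), v (u i)‖ ≤ b / √(m : ℝ) := by
    have hm0 : (0 : ℝ) < m := by exact_mod_cast hm
    have hcongr : ∑ i ∈ range (m * l), v (u i) = ∑ i ∈ range (m * l), v (samplePos L l s i) :=
      sum_congr rfl fun i hi => by rw [hu i (mem_range.1 hi)]
    rw [hcongr, norm_sub_rev]
    push_cast
    rw [mul_inv, mul_inv, mul_smul, mul_smul, ← smul_sub, norm_smul, norm_inv, Real.norm_natCast]
    calc _ ≤ (m : ℝ)⁻¹ * (b * √(m : ℝ)) := by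
          gcongr
          exact h m
      _ = _ := by
          have hs : √(m : ℝ) ≠ 0 := (Real.sqrt_pos.2 hm0).ne'
          nth_rw 1 [← Real.mul_self_sqrt hm0.le]
          field_simp
  rw [norm_sub_rev] at h2
  push_cast at h1 h2 h3 ⊢
  calc _ ≤ _ := norm_sub_le_norm_sub_add_norm_sub _ _ _
    _ ≤ _ := add_le_add h1 ((norm_sub_le_norm_sub_add_norm_sub _ _ _).trans (add_le_add h3 h2))
    _ = _ := by ring

end Sampling

/-! ### The compressed sequence -/

/-- Parameters of a compression: `n` blocks of length `l`, taken from `n` strata of length `L`,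
followed by the last `τ + 1` tokens of a sequence of length `n * L + k`. All errors will be of the
order `D⁻¹`. -/
structure Compression (τ n l L k : ℕ) (D β : ℝ) : Prop where
  tau_le : τ + 1 ≤ D
  sq_le : D ^ 2 ≤ n
  le_block : D ≤ l
  block_le : l ≤ L
  rem_lt : k < n
  len_le : n * l + τ + 1 ≤ n * L + k
  rate : ((n * l + τ + 1 : ℕ) : ℝ) ^ (-β) ≤ D⁻¹
  beta_nonneg : 0 ≤ β
  beta_le : β ≤ 1 / 2

/-- The position of the long sequence that is copied to position `i` of the compressed one. -/
def readPos (τ n l L k : ℕ) (s : ℕ → ℕ) (i : ℕ) : ℕ :=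
  if i < n * l then samplePos L l s i else n * L + k - (τ + 1) + (i - n * l)

theorem readPos_mul_add {τ n l L k : ℕ} (s : ℕ → ℕ) {m r : ℕ} (hm : m < n) (hr : r < l) :
    readPos τ n l L k s (m * l + r) = m * L + (s m + r) % L := by
  have : m * l + r < n * l := by
    calc m * l + r < m * l + l := by omega
      _ = (m + 1) * l := by ring
      _ ≤ n * l := Nat.mul_le_mul_right _ hm
  rw [readPos, if_pos this, samplePos_mul_add _ _ hr]

theorem readPos_eq_samplePos {τ n l L k m i : ℕ} (s : ℕ → ℕ) (hm : m ≤ n) (hi : i < m * l) :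
    readPos τ n l L k s i = samplePos L l s i :=
  if_pos (hi.trans_le (Nat.mul_le_mul_right _ hm))

/-- Away from the block start (`htr`) and the wrap-around (`hts`), stepping back in the compressed
sequence is stepping back in the original, so local contexts agree. -/
theorem readPos_mul_add_sub {τ n l L k : ℕ} (s : ℕ → ℕ) {m r t : ℕ} (hm : m < n) (hr : r < l)
    (htr : t ≤ r) (hts : t ≤ (s m + r) % L) :
    readPos τ n l L k s (m * l + r - t) = readPos τ n l L k s (m * l + r) - t := by
  rw [Nat.add_sub_assoc htr, readPos_mul_add s hm (by omega), readPos_mul_add s hm hr,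
    Nat.add_sub_assoc hts, ← Nat.add_sub_assoc htr]
  congr 1
  rcases Nat.eq_zero_or_pos L with rfl | hL
  · simp
  conv_lhs => rw [← Nat.mod_add_div (s m + r) L, Nat.sub_add_comm hts, Nat.add_mul_mod_self_left]
  exact Nat.mod_eq_of_lt ((Nat.sub_le _ _).trans_lt (Nat.mod_lt _ hL))

theorem readPos_last_sub {τ n l L k N t : ℕ} (s : ℕ → ℕ) (hN : n * L + k = N + 1) (hτ : τ ≤ N)
    (ht : t ≤ τ) : readPos τ n l L k s (n * l + τ - t) = N - t := by
  rw [readPos, if_neg (by omega)]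
  omega

namespace Compression

variable {τ n l L k : ℕ} {D β : ℝ}

theorem one_le (C : Compression τ n l L k D β) : 1 ≤ D := le_trans (by simp) C.tau_le

theorem pos (C : Compression τ n l L k D β) : 0 < D := one_pos.trans_le C.one_le

theorem n_pos (C : Compression τ n l L k D β) : 0 < n := lt_of_le_of_lt (Nat.zero_le _) C.rem_lt

theorem l_pos (C : Compression τ n l L k D β) : 0 < l := by exact_mod_cast C.pos.trans_le C.le_block

theorem L_pos (C : Compression τ n l L k D β) : 0 < L := C.l_pos.trans_le C.block_le

theorem le_n (C : Compression τ n l L k D β) : D ≤ n := le_trans (by nlinarith [C.one_le]) C.sq_le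

theorem inv_sqrt_le (C : Compression τ n l L k D β) : (√(n : ℝ))⁻¹ ≤ D⁻¹ :=
  inv_anti₀ C.pos (Real.le_sqrt_of_sq_le C.sq_le)

/-- The constant is `2 + 2 + 8`: the remainder `k` of the strata, the appended `τ + 1` tokens, and
the sampling error `8 / √n`. -/
theorem norm_avg_sub_le (C : Compression τ n l L k D β) {F : Type*} [NormedAddCommGroup F]
    [NormedSpace ℝ F] {s : ℕ → ℕ} {v : ℕ → F} {c : ℝ}
    (hs : SampleClose L l s (8 * c) v) (hv : ∀ i, ‖v i‖ ≤ c) :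
    ‖((n * L + k : ℕ) : ℝ)⁻¹ • ∑ i ∈ range (n * L + k), v i
      - ((n * l + τ + 1 : ℕ) : ℝ)⁻¹ • ∑ i ∈ range (n * l + τ + 1), v (readPos τ n l L k s i)‖
      ≤ c * (12 * D⁻¹) := by
  have hc : 0 ≤ c := (norm_nonneg _).trans (hv 0)
  have hn : (0 : ℝ) < n := by exact_mod_cast C.n_pos
  have hl : (0 : ℝ) < l := by exact_mod_cast C.l_pos
  have hL : (0 : ℝ) < L := by exact_mod_cast C.L_pos
  refine (hs.avg_sub_le hv C.L_pos C.l_pos C.n_pos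
    (fun i hi => readPos_eq_samplePos s le_rfl hi) k (τ + 1)).trans ?_
  have h1 : (k : ℝ) / (n * L) ≤ D⁻¹ := by
    have hk : (k : ℝ) ≤ n := by exact_mod_cast C.rem_lt.le
    have hlL : (l : ℝ) ≤ L := by exact_mod_cast C.block_le
    calc (k : ℝ) / (n * L) ≤ n / (n * L) := by gcongr
      _ = (L : ℝ)⁻¹ := by field_simp
      _ ≤ _ := inv_anti₀ C.pos (C.le_block.trans hlL)
  have h2 : ((τ + 1 : ℕ) : ℝ) / (n * l) ≤ D⁻¹ := by
    have hτ : ((τ + 1 : ℕ) : ℝ) ≤ l := by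
      push_cast
      exact C.tau_le.trans C.le_block
    calc ((τ + 1 : ℕ) : ℝ) / (n * l) ≤ l / (n * l) := by gcongr
      _ = (n : ℝ)⁻¹ := by field_simp
      _ ≤ _ := inv_anti₀ C.pos C.le_n
  have h3 := C.inv_sqrt_le
  calc _ ≤ 2 * c * D⁻¹ + 2 * c * D⁻¹ + 8 * c * D⁻¹ := by
        rw [div_eq_mul_inv (8 * c)]
        gcongr
    _ = _ := by ring

variable {α : Type*} [DecidableEq α] {X : ℕ → α} {s : ℕ → ℕ}

theorem freq_last_sub_le (C : Compression τ n l L k D β) {a : α} {N : ℕ} (hN : n * L + k = N + 1)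
    (hs : SampleClose L l s 8 fun j => if X j = a then (1 : ℝ) else 0) :
    |freq X N a - freq (fun i => X (readPos τ n l L k s i)) (n * l + τ) a| ≤ 12 * D⁻¹ := by
  have h := C.norm_avg_sub_le (c := 1) (v := fun j => if X j = a then (1 : ℝ) else 0)
    (by simpa using hs) (fun i => by split_ifs <;> simp)
  rw [hN, one_mul] at h
  simpa [freq] using h

/-- Before this position lie `m` complete blocks; the current partial stratum and partial block are
each at most a fraction `1 / m` of what precedes. -/
theorem freq_sub_le (C : Compression τ n l L k D β) {a : α}
    (hs : SampleClose L l s 8 fun j => if X j = a then (1 : ℝ) else 0) {m r : ℕ} (hm0 : 0 < m)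
    (hm : m < n) (hr : r < l) :
    |freq X (readPos τ n l L k s (m * l + r)) a
      - freq (fun i => X (readPos τ n l L k s i)) (m * l + r) a| ≤ 12 * (√(m : ℝ))⁻¹ := by
  have hm1 : (1 : ℝ) ≤ m := by exact_mod_cast hm0
  have hl : (0 : ℝ) < l := by exact_mod_cast C.l_pos
  have hL : (0 : ℝ) < L := by exact_mod_cast C.L_pos
  have h := hs.avg_sub_le (c := 1) (fun i => by split_ifs <;> simp) C.L_pos C.l_pos hm0
    (fun i hi => readPos_eq_samplePos (τ := τ) (k := k) s hm.le hi) ((s m + r) % L + 1) (r + 1)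
  rw [readPos_mul_add s hm hr]
  have hsq : (m : ℝ)⁻¹ ≤ (√(m : ℝ))⁻¹ :=
    inv_anti₀ (Real.sqrt_pos.2 (by linarith)) (Real.sqrt_le_iff.2 ⟨by linarith, by nlinarith⟩)
  have h1 : (((s m + r) % L + 1 : ℕ) : ℝ) / (m * L) ≤ (√(m : ℝ))⁻¹ := by
    have hk : (((s m + r) % L + 1 : ℕ) : ℝ) ≤ L := by exact_mod_cast Nat.mod_lt _ C.L_pos
    calc _ ≤ (L : ℝ) / (m * L) := by gcongr
      _ = (m : ℝ)⁻¹ := by field_simp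
      _ ≤ _ := hsq
  have h2 : ((r + 1 : ℕ) : ℝ) / (m * l) ≤ (√(m : ℝ))⁻¹ := by
    have hk : ((r + 1 : ℕ) : ℝ) ≤ l := by exact_mod_cast hr
    calc _ ≤ (l : ℝ) / (m * l) := by gcongr
      _ = (m : ℝ)⁻¹ := by field_simp
      _ ≤ _ := hsq
  rw [Real.norm_eq_abs] at h
  unfold freq
  have hcast : ∀ j : ℕ, ((j + 1 : ℕ) : ℝ) = (j : ℝ) + 1 := fun j => by push_cast; rfl
  simp only [← add_assoc, smul_eq_mul, hcast] at h h1 h2 ⊢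
  refine h.trans ?_
  rw [div_eq_mul_inv 8]
  linarith

/-- Number of those positions of the compressed sequence, counted with multiplicity, at which
the comparison with the long sequence is not controlled. -/
theorem sum_bad_le (C : Compression τ n l L k D β) :
    ∑ i ∈ range (n * l), ((if i < l then (1 : ℝ) else 0) + (if i % l < τ then (1 : ℝ) else 0)
      + (if (s (i / l) + i % l) % L < τ then (1 : ℝ) else 0)) ≤ l + 2 * τ * n := by
  have hcount : ∀ N M : ℕ, ∑ i ∈ range N, (if i < M then (1 : ℝ) else 0) ≤ M := fun N M => by
    rw [sum_boole]
    have : #{i ∈ range N | i < M} ≤ #(range M) := card_le_card fun i hi => by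
      simpa using (mem_filter.1 hi).2
    rw [card_range] at this
    exact_mod_cast this
  have hdm : ∀ m r, r < l → (m * l + r) / l = m ∧ (m * l + r) % l = r := fun m r hr => by
    rw [mul_comm, Nat.mul_add_div C.l_pos, Nat.div_eq_of_lt hr, Nat.mul_add_mod,
      Nat.mod_eq_of_lt hr]
    simp
  have h2 : ∑ i ∈ range (n * l), (if i % l < τ then (1 : ℝ) else 0) ≤ n * τ := by
    rw [sum_range_mul]
    refine (sum_le_sum (g := fun _ => (τ : ℝ)) fun m _ => ?_).trans (by simp)
    rw [sum_congr rfl fun r hr => by rw [(hdm m r (mem_range.1 hr)).2]]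
    exact hcount _ _
  have h3 : ∑ i ∈ range (n * l), (if (s (i / l) + i % l) % L < τ then (1 : ℝ) else 0)
      ≤ n * τ := by
    rw [sum_range_mul]
    refine (sum_le_sum (g := fun _ => (τ : ℝ)) fun m _ => ?_).trans (by simp)
    rw [sum_congr rfl fun r hr => by
      rw [(hdm m r (mem_range.1 hr)).1, (hdm m r (mem_range.1 hr)).2]]
    -- The window is enlarged to a full rotation of the stratum, which meets each residue below `τ`
    -- at most once.
    calc _ ≤ ∑ r ∈ range L, (if (s m + r) % L < τ then (1 : ℝ) else 0) :=
          sum_le_sum_of_subset_of_nonneg (range_subset_range.2 C.block_le) fun _ _ _ => by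
            split_ifs <;> simp
      _ = ∑ r ∈ range L, (if r < τ then (1 : ℝ) else 0) := by
          simp only [add_comm (s m)]
          exact sum_range_add_mod (fun j => if j < τ then (1 : ℝ) else 0) (s m)
      _ ≤ τ := hcount _ _
  rw [sum_add_distrib, sum_add_distrib]
  linarith [hcount (n * l) l]

variable [Fintype α] {H d o : ℕ} {f : TwoLayer α H d o}

/-- Everything is expressed through the compressed position, to be summed later. As `I ≤ 2 * (m *
l)`, the original position is at least of order `I / 2`, and `1 / √m` is at most `2 * √(l / I)`. -/
theorem hidden_sub_le (C : Compression τ n l L k D β) (hf : f.MemClass τ)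
    (hg : ∀ h, ∃ p, PosGap τ (f.layer1.head h).φ p β)
    (hs : ∀ a, SampleClose L l s 8 fun j => if X j = a then (1 : ℝ) else 0) {m r : ℕ}
    (hm0 : 0 < m) (hm : m < n) (hr : r < l) (hτr : τ ≤ r) (hτs : τ ≤ (s m + r) % L) :
    ‖f.hidden X (readPos τ n l L k s (m * l + r))
      - f.hidden (fun i => X (readPos τ n l L k s i)) (m * l + r)‖ ≤
      f.radius * Real.exp (2 * ∑ h, ‖(f.layer1.head h).KQ‖) *
        (12 * (τ + 1) * (((m * l + r : ℕ) : ℝ) + 1) ^ (-β)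
          + 48 * Fintype.card α * (√(l : ℝ) * (√(((m * l + r : ℕ) : ℝ) + 1))⁻¹)) := by
  have hm1 : (1 : ℝ) ≤ m := by exact_mod_cast hm0
  have hl : (0 : ℝ) < l := by exact_mod_cast C.l_pos
  have hrad := f.one_le_radius
  set I : ℝ := ((m * l + r : ℕ) : ℝ) + 1 with hI
  have hI0 : 0 < I := by positivity
  have hIle : I ≤ 2 * (m * l) := by
    have h1 : (r : ℝ) + 1 ≤ l := by exact_mod_cast hr
    rw [hI]
    push_cast
    nlinarith
  have hpos : readPos τ n l L k s (m * l + r) = m * L + (s m + r) % L := readPos_mul_add s hm hr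
  refine (TwoLayer.hidden_sub_le hf hg (η := 12 * (√(m : ℝ))⁻¹) (by positivity) (by omega)
    (by omega) (fun t ht => ?_) fun a => C.freq_sub_le (hs a) hm0 hm hr).trans ?_
  · rw [readPos_mul_add_sub s hm hr (ht.trans hτr) (ht.trans hτs)]
  · have h1 : ((readPos τ n l L k s (m * l + r) : ℝ) + 1) ^ (-β) ≤ 2 * I ^ (-β) := by
      have h2 : I / 2 ≤ (readPos τ n l L k s (m * l + r) : ℝ) + 1 := by
        have h3 : m * l ≤ readPos τ n l L k s (m * l + r) := by
          rw [hpos]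
          exact (Nat.mul_le_mul_left _ C.block_le).trans (Nat.le_add_right _ _)
        have h4 : (m : ℝ) * l ≤ readPos τ n l L k s (m * l + r) := by exact_mod_cast h3
        linarith
      calc _ ≤ (I / 2) ^ (-β) :=
            Real.rpow_le_rpow_of_nonpos (by positivity) h2 (by linarith [C.beta_nonneg])
        _ = I ^ (-β) * 2 ^ β := by
            rw [Real.div_rpow hI0.le (by norm_num), Real.rpow_neg (by norm_num : (0:ℝ) ≤ 2),
              div_inv_eq_mul]
        _ ≤ I ^ (-β) * 2 ^ (1 : ℝ) := by
            gcongr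
            · norm_num
            · linarith [C.beta_le]
        _ = _ := by rw [Real.rpow_one, mul_comm]
    have h2 : (√(m : ℝ))⁻¹ ≤ 2 * (√(l : ℝ) * (√I)⁻¹) := by
      have h3 : √I ≤ 2 * (√(m : ℝ) * √(l : ℝ)) := by
        rw [← Real.sqrt_mul (by positivity)]
        refine Real.sqrt_le_iff.2 ⟨by positivity, ?_⟩
        rw [mul_pow, Real.sq_sqrt (by positivity)]
        nlinarith [mul_nonneg (by linarith : (0 : ℝ) ≤ m) hl.le]
      have h4 : 0 < √I := Real.sqrt_pos.2 hI0
      have h5 : 0 < √(m : ℝ) := Real.sqrt_pos.2 (by linarith)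
      rw [inv_le_iff_one_le_mul₀ h5]
      calc (1 : ℝ) = √I * (√I)⁻¹ := (mul_inv_cancel₀ h4.ne').symm
        _ ≤ 2 * (√(m : ℝ) * √(l : ℝ)) * (√I)⁻¹ := by gcongr
        _ = _ := by ring
    gcongr ?_ * ?_
    calc _ ≤ 4 * (τ + 1) * (2 * I ^ (-β) + I ^ (-β))
          + 2 * (Fintype.card α * (12 * (2 * (√(l : ℝ) * (√I)⁻¹)))) := by gcongr
      _ = _ := by ring

theorem hidden_last_sub_le (C : Compression τ n l L k D β) (hf : f.MemClass τ)
    (hg : ∀ h, ∃ p, PosGap τ (f.layer1.head h).φ p β)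
    (hs : ∀ a, SampleClose L l s 8 fun j => if X j = a then (1 : ℝ) else 0) {N : ℕ}
    (hN : n * L + k = N + 1) :
    ‖f.hidden X N - f.hidden (fun i => X (readPos τ n l L k s i)) (n * l + τ)‖ ≤
      f.radius * Real.exp (2 * ∑ h, ‖(f.layer1.head h).KQ‖) *
        ((8 * (τ + 1) + 24 * Fintype.card α) * D⁻¹) := by
  have hD := C.pos
  have hrad := f.one_le_radius
  have hlen := C.len_le
  have hτN : τ ≤ N := by omega
  refine (TwoLayer.hidden_sub_le hf hg (η := 12 * D⁻¹) (by positivity) hτN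
    (Nat.le_add_left _ _) (fun t ht => ?_) fun a => C.freq_last_sub_le hN (hs a)).trans ?_
  · simp only [readPos_last_sub s hN hτN ht]
  · have h1 : (((n * l + τ : ℕ) : ℝ) + 1) ^ (-β) ≤ D⁻¹ := by
      have := C.rate
      rwa [Nat.cast_add_one] at this
    have h2 : ((N : ℝ) + 1) ^ (-β) ≤ D⁻¹ := by
      refine le_trans (Real.rpow_le_rpow_of_nonpos (by positivity) ?_
        (by linarith [C.beta_nonneg])) h1
      have : n * l + τ + 1 ≤ N + 1 := by omega
      exact_mod_cast this
    gcongr ?_ * ?_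
    calc _ ≤ 4 * (τ + 1) * (D⁻¹ + D⁻¹) + 2 * (Fintype.card α * (12 * D⁻¹)) := by gcongr
      _ = _ := by ring

/-- Good positions obey the pointwise bound `A * G i`, whose sum gives `24` and `96`. Bad positions
and the appended tail cost `2 * R` each, and their fraction of order `(τ + 1) / D` adds the
remaining `4`. -/
theorem sum_hidden_sub_le (C : Compression τ n l L k D β) (hf : f.MemClass τ)
    (hg : ∀ h, ∃ p, PosGap τ (f.layer1.head h).φ p β)
    (hs : ∀ a, SampleClose L l s 8 fun j => if X j = a then (1 : ℝ) else 0) :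
    ((n * l + τ + 1 : ℕ) : ℝ)⁻¹ * ∑ i ∈ range (n * l + τ + 1),
        ‖f.hidden X (readPos τ n l L k s i) - f.hidden (fun i => X (readPos τ n l L k s i)) i‖ ≤
      f.radius * Real.exp (2 * ∑ h, ‖(f.layer1.head h).KQ‖) *
        ((28 * (τ + 1) + 96 * Fintype.card α) * D⁻¹) := by
  have hD := C.pos
  have hn : (0 : ℝ) < n := by exact_mod_cast C.n_pos
  have hl : (0 : ℝ) < l := by exact_mod_cast C.l_pos
  have hrad := f.one_le_radius
  set e : ℕ → ℝ := fun i =>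
    ‖f.hidden X (readPos τ n l L k s i) - f.hidden (fun i => X (readPos τ n l L k s i)) i‖ with he
  set R := f.radius with hR
  set k' : ℝ := ∑ h, ‖(f.layer1.head h).KQ‖ with hk'
  have hk0 : 0 ≤ k' := sum_nonneg fun _ _ => norm_nonneg _
  set A := R * Real.exp (2 * k') with hA
  have hA0 : 0 ≤ A := by positivity
  have hRA : R ≤ A := le_mul_of_one_le_right (by linarith) (Real.one_le_exp (by linarith))
  set G : ℕ → ℝ := fun i => 12 * (τ + 1) * ((i : ℝ) + 1) ^ (-β)
    + 48 * Fintype.card α * (√(l : ℝ) * (√((i : ℝ) + 1))⁻¹) with hGdef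
  have hG0 : ∀ i, 0 ≤ G i := fun i => by positivity
  set bad : ℕ → ℝ := fun i => (if i < l then (1 : ℝ) else 0) + (if i % l < τ then (1 : ℝ) else 0)
      + (if (s (i / l) + i % l) % L < τ then (1 : ℝ) else 0) with hbad
  have hcrude : ∀ i, e i ≤ 2 * R := fun i => by
    have h1 := TwoLayer.norm_hidden_le hf X (readPos τ n l L k s i)
    have h2 := TwoLayer.norm_hidden_le hf (fun i => X (readPos τ n l L k s i)) i
    have h3 := norm_sub_le (f.hidden X (readPos τ n l L k s i))
      (f.hidden (fun i => X (readPos τ n l L k s i)) i)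
    simp only [he]
    linarith
  have hbody : ∀ i ∈ range (n * l), e i ≤ A * G i + 2 * R * bad i := fun i hi => by
    have hb1 : (0 : ℝ) ≤ if i < l then (1 : ℝ) else 0 := by split_ifs <;> simp
    have hb2 : (0 : ℝ) ≤ if i % l < τ then (1 : ℝ) else 0 := by split_ifs <;> simp
    have hb3 : (0 : ℝ) ≤ if (s (i / l) + i % l) % L < τ then (1 : ℝ) else 0 := by
      split_ifs <;> simp
    by_cases hgood : ¬ i < l ∧ ¬ i % l < τ ∧ ¬ (s (i / l) + i % l) % L < τ
    · obtain ⟨h1, h2, h3⟩ := hgood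
      have hb : bad i = 0 := by simp only [hbad, if_neg h1, if_neg h2, if_neg h3, add_zero]
      have hdm : i / l * l + i % l = i := Nat.div_add_mod' i l
      have h4 := C.hidden_sub_le hf hg hs (m := i / l) (r := i % l)
        (Nat.div_pos (not_lt.1 h1) C.l_pos)
        ((Nat.div_lt_iff_lt_mul C.l_pos).2 (mem_range.1 hi)) (Nat.mod_lt _ C.l_pos)
        (not_lt.1 h2) (not_lt.1 h3)
      rw [hdm] at h4
      rw [hb, mul_zero, add_zero]
      exact h4
    · have hb : 1 ≤ bad i := by
        simp only [hbad]
        by_cases h1 : i < l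
        · rw [if_pos h1]
          linarith
        by_cases h2 : i % l < τ
        · rw [if_pos h2]
          linarith
        have h3 : (s (i / l) + i % l) % L < τ := by tauto
        rw [if_pos h3]
        linarith
      have h5 : 0 ≤ A * G i := mul_nonneg hA0 (hG0 i)
      have h6 := hcrude i
      nlinarith
  set N : ℕ := n * l + τ + 1 with hN
  have hNcast : (N : ℝ) = n * l + (τ + 1) := by
    rw [hN]
    push_cast
    ring
  have hN0 : (0 : ℝ) < N := by rw [hNcast]; positivity
  have hτ0 : (0 : ℝ) ≤ τ := by positivity
  have hsumG : ∑ i ∈ range N, G i ≤ N * ((24 * (τ + 1) + 96 * Fintype.card α) * D⁻¹) := by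
    have h1 := sum_rpow_neg_le C.beta_le N
    have h2 := sum_inv_sqrt_le N
    have h3 : √(l : ℝ) * (2 * √(N : ℝ)) ≤ N * (2 * D⁻¹) := by
      -- Equivalent to `l * D ^ 2 ≤ N`, which holds because there are `n ≥ D ^ 2` blocks.
      have h4 : √(l : ℝ) ≤ √(N : ℝ) * D⁻¹ := by
        refine Real.sqrt_le_iff.2 ⟨by positivity, ?_⟩
        rw [mul_pow, Real.sq_sqrt hN0.le, inv_pow, ← div_eq_mul_inv, le_div_iff₀ (by positivity)]
        calc (l : ℝ) * D ^ 2 ≤ l * n := by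
              gcongr
              exact C.sq_le
          _ ≤ N := by rw [hNcast]; linarith
      calc _ ≤ √(N : ℝ) * D⁻¹ * (2 * √(N : ℝ)) := by gcongr
        _ = (√(N : ℝ) * √(N : ℝ)) * (2 * D⁻¹) := by ring
        _ = _ := by rw [Real.mul_self_sqrt hN0.le]
    simp only [hGdef]
    rw [sum_add_distrib, ← mul_sum, ← mul_sum, ← mul_sum]
    calc _ ≤ 12 * (τ + 1) * (2 * N * D⁻¹) + 48 * Fintype.card α * (N * (2 * D⁻¹)) := by
          refine add_le_add (mul_le_mul_of_nonneg_left (h1.trans ?_) (by positivity))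
            (mul_le_mul_of_nonneg_left ((mul_le_mul_of_nonneg_left h2 (by positivity)).trans h3)
              (by positivity))
          gcongr
          exact C.rate
      _ = _ := by ring
  have hsumbad : l + 2 * τ * n + (τ + 1) ≤ N * (2 * (τ + 1) * D⁻¹) := by
    have h1 : (l : ℝ) ≤ N * D⁻¹ := by
      rw [← div_eq_mul_inv, le_div_iff₀ hD, hNcast]
      nlinarith [C.le_n]
    have h2 : (n : ℝ) ≤ N * D⁻¹ := by
      rw [← div_eq_mul_inv, le_div_iff₀ hD, hNcast]
      nlinarith [C.le_block]
    have h3 : (τ : ℝ) + 1 ≤ N * D⁻¹ := (C.tau_le.trans C.le_n).trans h2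
    have h4 : 2 * τ * (n : ℝ) ≤ 2 * τ * (N * D⁻¹) := by gcongr
    linarith
  have htotal : ∑ i ∈ range N, e i ≤ N * (A * ((28 * (τ + 1) + 96 * Fintype.card α) * D⁻¹)) := by
    have hsplit : ∑ i ∈ range N, e i ≤ A * ∑ i ∈ range N, G i
        + 2 * R * (l + 2 * τ * n + (τ + 1)) := by
      have h1 : ∑ i ∈ range (n * l), e i ≤ A * ∑ i ∈ range (n * l), G i
          + 2 * R * (l + 2 * τ * n) := by
        refine (sum_le_sum hbody).trans ?_
        rw [sum_add_distrib, ← mul_sum, ← mul_sum]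
        gcongr
        exact C.sum_bad_le
      have h2 : ∑ i ∈ range (τ + 1), e (n * l + i) ≤ 2 * R * (τ + 1) := by
        refine (sum_le_sum fun i _ => hcrude _).trans ?_
        simp [mul_comm]
      have h3 : ∑ i ∈ range (n * l), G i ≤ ∑ i ∈ range N, G i :=
        sum_le_sum_of_subset_of_nonneg (range_subset_range.2 (by omega)) fun i _ _ => hG0 i
      have h4 : A * ∑ i ∈ range (n * l), G i ≤ A * ∑ i ∈ range N, G i := by gcongr
      rw [hN, add_assoc, sum_range_add]
      rw [hN, add_assoc] at h4
      linarith
    have h5 : 2 * R * (l + 2 * τ * n + (τ + 1)) ≤ 2 * A * (N * (2 * (τ + 1) * D⁻¹)) := by gcongr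
    have h6 : A * ∑ i ∈ range N, G i
        ≤ A * (N * ((24 * (τ + 1) + 96 * Fintype.card α) * D⁻¹)) := by gcongr
    calc _ ≤ _ := hsplit.trans (add_le_add h6 h5)
      _ = _ := by ring
  rwa [inv_mul_le_iff₀ hN0]

end Compression

/-! ### Stability of the output under compression -/

namespace TwoLayer

variable {α : Type*} {H d m : ℕ}

/-- The quantity whose cube controls the exponential part of the complexity. -/
def expSize (f : TwoLayer α H d m) : ℝ :=
  f.radius + ‖(f.layer2.head 0).KQ‖ + ∑ h, ‖(f.layer1.head h).KQ‖

/-- The stability constant of the output with respect to the compression of sequences. -/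
def stability [Fintype α] (τ : ℕ) (f : TwoLayer α H d m) : ℝ :=
  Real.exp (13 * f.expSize ^ 3) * (‖f.U‖ * (1 + ‖f.layer2.B‖ * ‖f.layer2.A‖) *
    (1 + ‖(f.layer2.head 0).V‖) * (100 * (τ + 1 + Fintype.card α)))

theorem one_le_expSize (f : TwoLayer α H d m) : 1 ≤ f.expSize := by
  have h1 := f.one_le_radius
  have h2 : 0 ≤ ‖(f.layer2.head 0).KQ‖ := norm_nonneg _
  have h3 : 0 ≤ ∑ h, ‖(f.layer1.head h).KQ‖ := sum_nonneg fun _ _ => norm_nonneg _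
  unfold expSize
  linarith

/-- With `S = expSize`, the factors are at most exponentials of `2`, `8`, `1` and `2` times `S ^ 3`,
whence `13`; linear terms are absorbed by `x + 1 ≤ exp x`. -/
theorem le_exp_expSize (f : TwoLayer α H d m) :
    Real.exp (2 * (‖(f.layer2.head 0).KQ‖ * f.radius ^ 2)) *
      (4 * (‖(f.layer2.head 0).KQ‖ * f.radius ^ 2) + 2 * f.radius + 2) *
      (f.radius * Real.exp (2 * ∑ h, ‖(f.layer1.head h).KQ‖))
      ≤ Real.exp (13 * f.expSize ^ 3) := by
  have hr := f.one_le_radius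
  have hq : 0 ≤ ‖(f.layer2.head 0).KQ‖ := norm_nonneg _
  have hk : 0 ≤ ∑ h, ‖(f.layer1.head h).KQ‖ := sum_nonneg fun _ _ => norm_nonneg _
  have hS := f.one_le_expSize
  have hSdef : f.expSize = f.radius + ‖(f.layer2.head 0).KQ‖ + ∑ h, ‖(f.layer1.head h).KQ‖ := rfl
  set r := f.radius
  set q := ‖(f.layer2.head 0).KQ‖
  set k := ∑ h, ‖(f.layer1.head h).KQ‖
  set S := f.expSize
  have hS3 : S ≤ S ^ 3 := le_self_pow₀ hS (by norm_num)
  have hκ : q * r ^ 2 ≤ S ^ 3 := by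
    calc q * r ^ 2 ≤ S * S ^ 2 := by
          gcongr <;> linarith
      _ = S ^ 3 := by ring
  have h1 : 4 * (q * r ^ 2) + 2 * r + 2 ≤ Real.exp (8 * S ^ 3) := by
    have := Real.add_one_le_exp (8 * S ^ 3)
    linarith
  have h2 : r ≤ Real.exp (S ^ 3) := by
    have := Real.add_one_le_exp (S ^ 3)
    linarith
  have h3 : Real.exp (2 * k) ≤ Real.exp (2 * S ^ 3) := Real.exp_le_exp.2 (by linarith)
  have h4 : Real.exp (2 * (q * r ^ 2)) ≤ Real.exp (2 * S ^ 3) := Real.exp_le_exp.2 (by linarith)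
  calc _ ≤ Real.exp (2 * S ^ 3) * Real.exp (8 * S ^ 3) *
        (Real.exp (S ^ 3) * Real.exp (2 * S ^ 3)) := by gcongr
    _ = _ := by
      rw [← Real.exp_add, ← Real.exp_add, ← Real.exp_add]
      congr 1
      ring

theorem evalNat_sub_le (f : TwoLayer α H d m) (X X' : ℕ → α) (n n' : ℕ) :
    ‖f.evalNat X n - f.evalNat X' n'‖ ≤ ‖f.U‖ * ((1 + ‖f.layer2.B‖ * ‖f.layer2.A‖) *
      (‖f.hidden X n - f.hidden X' n'‖ + ‖(f.layer2.head 0).attendNat (f.hidden X) n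
        - (f.layer2.head 0).attendNat (f.hidden X') n'‖)) := by
  unfold evalNat
  rw [← map_sub]
  refine (f.U.le_opNorm _).trans ?_
  gcongr
  refine (f.layer2.mlp_sub_le _ _).trans ?_
  gcongr
  unfold Layer.preNat
  rw [Fin.sum_univ_one, Fin.sum_univ_one, add_sub_add_comm]
  exact norm_add_le _ _

/-- Attention weights of the second layer for the last position `N` of `X`. -/
def weight (f : TwoLayer α H d m) (X : ℕ → α) (N i : ℕ) : ℝ :=
  (f.layer2.head 0).weight (f.hidden X) N i

theorem abs_weight_le {τ : ℕ} {f : TwoLayer α H d m} (hf : f.MemClass τ) (X : ℕ → α) (N i : ℕ) :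
    ‖f.weight X N i‖ ≤ Real.exp (‖(f.layer2.head 0).KQ‖ * f.radius ^ 2) := by
  rw [weight, Head.weight, Real.norm_of_nonneg (Real.exp_pos _).le]
  exact Real.exp_le_exp.2 (abs_le.1 ((f.layer2.head 0).abs_inner_le (norm_hidden_le hf X i)
    (norm_hidden_le hf X N))).2

theorem norm_weight_smul_le {τ : ℕ} {f : TwoLayer α H d m} (hf : f.MemClass τ) (X : ℕ → α)
    (N i : ℕ) : ‖f.weight X N i • f.hidden X i‖
      ≤ Real.exp (‖(f.layer2.head 0).KQ‖ * f.radius ^ 2) * f.radius := by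
  rw [norm_smul]
  gcongr
  · exact abs_weight_le hf X N i
  · exact norm_hidden_le hf X i

/-- The features of a position that are averaged by the second layer, rescaled to norm one. -/
def feature (f : TwoLayer α H d m) (X : ℕ → α) (N i : ℕ) : WithLp 2 (ℝ × Vec d) :=
  WithLp.toLp 2
    ((Real.exp (‖(f.layer2.head 0).KQ‖ * f.radius ^ 2))⁻¹ • f.weight X N i,
      (Real.exp (‖(f.layer2.head 0).KQ‖ * f.radius ^ 2) * f.radius)⁻¹ •
        (f.weight X N i • f.hidden X i))

theorem norm_feature_le {τ : ℕ} {f : TwoLayer α H d m} (hf : f.MemClass τ) (X : ℕ → α)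
    (N i : ℕ) : ‖f.feature X N i‖ ≤ 2 := by
  have hr := f.one_le_radius
  have key : ∀ {E : Type} [NormedAddCommGroup E] [NormedSpace ℝ E] {v : E} {c : ℝ}, 0 < c →
      ‖v‖ ≤ c → ‖c⁻¹ • v‖ ^ 2 ≤ 1 := by
    intro E _ _ v c hc hv
    rw [norm_smul, norm_inv, Real.norm_of_nonneg hc.le]
    refine pow_le_one₀ (by positivity) ?_
    rwa [inv_mul_le_iff₀ hc, mul_one]
  have h1 := key (Real.exp_pos _) (abs_weight_le hf X N i)
  have h2 := key (by positivity) (norm_weight_smul_le hf X N i)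
  refine le_of_sq_le_sq ?_ (by norm_num)
  rw [feature, WithLp.prod_norm_sq_eq_of_L2]
  calc _ ≤ (1 : ℝ) + 1 := add_le_add h1 h2
    _ ≤ _ := by norm_num

theorem sampleClose_weight {L l : ℕ} {s : ℕ → ℕ} {f : TwoLayer α H d m} {X : ℕ → α} {N : ℕ}
    (h : SampleClose L l s 8 (f.feature X N)) :
    SampleClose L l s (8 * Real.exp (‖(f.layer2.head 0).KQ‖ * f.radius ^ 2)) (f.weight X N) := by
  have hexp := Real.exp_pos (‖(f.layer2.head 0).KQ‖ * f.radius ^ 2)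
  have h' := (h.map (WithLp.fstL 2 ℝ ℝ (Vec d)).toLinearMap
    fun x => WithLp.norm_fst_le _ x).smul hexp.le
  have heq : f.weight X N = fun i => Real.exp (‖(f.layer2.head 0).KQ‖ * f.radius ^ 2) •
      (WithLp.fstL 2 ℝ ℝ (Vec d)).toLinearMap (f.feature X N i) := by
    funext i
    exact (smul_inv_smul₀ hexp.ne' _).symm
  rw [mul_comm, heq]
  exact h'

theorem sampleClose_weight_smul {L l : ℕ} {s : ℕ → ℕ} {f : TwoLayer α H d m} {X : ℕ → α} {N : ℕ}
    (h : SampleClose L l s 8 (f.feature X N)) :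
    SampleClose L l s (8 * (Real.exp (‖(f.layer2.head 0).KQ‖ * f.radius ^ 2) * f.radius))
      fun i => f.weight X N i • f.hidden X i := by
  have hr : 0 < f.radius := one_pos.trans_le f.one_le_radius
  have hexp : 0 < Real.exp (‖(f.layer2.head 0).KQ‖ * f.radius ^ 2) * f.radius := by positivity
  have h' := (h.map (WithLp.sndL 2 ℝ ℝ (Vec d)).toLinearMap
    fun x => WithLp.norm_snd_le _ x).smul hexp.le
  have heq : (fun i => f.weight X N i • f.hidden X i) = fun i =>
      (Real.exp (‖(f.layer2.head 0).KQ‖ * f.radius ^ 2) * f.radius) •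
        (WithLp.sndL 2 ℝ ℝ (Vec d)).toLinearMap (f.feature X N i) := by
    funext i
    exact (smul_inv_smul₀ hexp.ne' _).symm
  rw [mul_comm, heq]
  exact h'

variable [Fintype α]

/-- A crude bound between arbitrary inputs, used when `ε` is so large that no compression is needed.
-/
theorem evalNat_sub_le_stability {τ : ℕ} {f : TwoLayer α H d m} (hf : f.MemClass τ)
    (X X' : ℕ → α) (n n' : ℕ) : ‖f.evalNat X n - f.evalNat X' n'‖ ≤ f.stability τ := by
  have hr := f.one_le_radius
  set r := f.radius
  set V := ‖(f.layer2.head 0).V‖ with hV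
  have hV0 : 0 ≤ V := norm_nonneg _
  have h1 : ‖f.hidden X n - f.hidden X' n'‖ ≤ 2 * r :=
    (norm_sub_le _ _).trans (by linarith [norm_hidden_le hf X n, norm_hidden_le hf X' n'])
  have h2 : ‖(f.layer2.head 0).attendNat (f.hidden X) n
      - (f.layer2.head 0).attendNat (f.hidden X') n'‖ ≤ 2 * (V * r) :=
    (norm_sub_le _ _).trans (by
      linarith [(f.layer2.head 0).norm_attendNat_le (norm_hidden_le hf X) n,
        (f.layer2.head 0).norm_attendNat_le (norm_hidden_le hf X') n'])
  have h3 : r ≤ Real.exp (13 * f.expSize ^ 3) := by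
    have hS := f.one_le_expSize
    have hS3 : f.expSize ≤ f.expSize ^ 3 := le_self_pow₀ hS (by norm_num)
    have hrS : r ≤ f.expSize := by
      have h2 : 0 ≤ ‖(f.layer2.head 0).KQ‖ := norm_nonneg _
      have h3 : 0 ≤ ∑ h, ‖(f.layer1.head h).KQ‖ := sum_nonneg fun _ _ => norm_nonneg _
      unfold expSize
      linarith
    have := Real.add_one_le_exp (13 * f.expSize ^ 3)
    linarith
  have h4 : (2 : ℝ) ≤ 100 * (τ + 1 + Fintype.card α) := by
    have h5 : (0 : ℝ) ≤ τ := by positivity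
    have h6 : (0 : ℝ) ≤ Fintype.card α := by positivity
    linarith
  calc _ ≤ ‖f.U‖ * ((1 + ‖f.layer2.B‖ * ‖f.layer2.A‖) * (2 * r + 2 * (V * r))) := by
        refine (f.evalNat_sub_le X X' n n').trans ?_
        gcongr
    _ = r * (‖f.U‖ * (1 + ‖f.layer2.B‖ * ‖f.layer2.A‖) * (1 + V) * 2) := by ring
    _ ≤ f.stability τ := by
        unfold stability
        gcongr

theorem evalNat_sub_le_of_compression [DecidableEq α] {τ n l L k : ℕ} {D β : ℝ}
    (C : Compression τ n l L k D β) {f : TwoLayer α H d m} (hf : f.MemClass τ)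
    (hg : ∀ h, ∃ p, PosGap τ (f.layer1.head h).φ p β) {X : ℕ → α} {s : ℕ → ℕ}
    (hs : ∀ a, SampleClose L l s 8 fun j => if X j = a then (1 : ℝ) else 0) {N : ℕ}
    (hN : n * L + k = N + 1) (hfeat : SampleClose L l s 8 (f.feature X N)) :
    ‖f.evalNat X N - f.evalNat (fun i => X (readPos τ n l L k s i)) (n * l + τ)‖
      ≤ f.stability τ * D⁻¹ := by
  have hr := f.one_le_radius
  have hD := C.pos
  set X' : ℕ → α := fun i => X (readPos τ n l L k s i) with hX'
  set r := f.radius with hrdef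
  set κ := ‖(f.layer2.head 0).KQ‖ * r ^ 2 with hκdef
  set V := ‖(f.layer2.head 0).V‖ with hV
  have hV0 : 0 ≤ V := norm_nonneg _
  have hκ0 : 0 ≤ κ := by positivity
  have hk : 0 ≤ ∑ h, ‖(f.layer1.head h).KQ‖ := sum_nonneg fun _ _ => norm_nonneg _
  set A := r * Real.exp (2 * ∑ h, ‖(f.layer1.head h).KQ‖) with hA
  have hA1 : 1 ≤ A :=
    one_le_mul_of_one_le_of_one_le hr (Real.one_le_exp (mul_nonneg zero_le_two hk))
  have hτ0 : (0 : ℝ) ≤ τ := by positivity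
  have hα0 : (0 : ℝ) ≤ Fintype.card α := by positivity
  -- The constant `100` dominates those of the sampling error, of the last position and of the
  -- averaged hidden error.
  set W : ℝ := 100 * (τ + 1 + Fintype.card α) with hW
  set δ := A * (W * D⁻¹) with hδ
  have hδ0 : 0 ≤ δ := by positivity
  have hδ12 : 12 * D⁻¹ ≤ δ := by
    calc 12 * D⁻¹ = 1 * (12 * D⁻¹) := by ring
      _ ≤ _ := by
        rw [hδ, hW]
        gcongr
        linarith
  have hw := sampleClose_weight hfeat
  have hwy := sampleClose_weight_smul hfeat
  have hlast : ‖f.hidden X N - f.hidden X' (n * l + τ)‖ ≤ δ := by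
    refine (C.hidden_last_sub_le hf hg hs hN).trans ?_
    rw [hδ, hW]
    gcongr
    linarith
  have havg := C.sum_hidden_sub_le hf hg hs
  have h1 := C.norm_avg_sub_le hw fun i => abs_weight_le hf X N i
  have h2 := C.norm_avg_sub_le hwy fun i => norm_weight_smul_le hf X N i
  rw [hN] at h1 h2
  have hatt := (f.layer2.head 0).attendNat_sub_le_of_avg (hf.layer2_eq_zero 0) hr (δ := δ)
    (norm_hidden_le hf X) (norm_hidden_le hf X') (n := N) (n' := n * l + τ)
    (readPos τ n l L k s)
    (havg.trans (by
      rw [hδ, hW]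
      gcongr
      linarith))
    hlast (h1.trans (by gcongr)) (h2.trans (by rw [mul_assoc]; gcongr))
  calc _ ≤ ‖f.U‖ * ((1 + ‖f.layer2.B‖ * ‖f.layer2.A‖) *
        (δ + V * Real.exp (2 * κ) * ((4 * κ + 2 * r + 1) * δ))) := by
        refine (f.evalNat_sub_le X X' N (n * l + τ)).trans ?_
        gcongr
    _ ≤ ‖f.U‖ * ((1 + ‖f.layer2.B‖ * ‖f.layer2.A‖) *
        ((1 + V) * (Real.exp (2 * κ) * (4 * κ + 2 * r + 2) * δ))) := by
        gcongr
        have h3 : 1 ≤ Real.exp (2 * κ) := Real.one_le_exp (by positivity)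
        have h4 : 1 * δ ≤ Real.exp (2 * κ) * (4 * κ + 2 * r + 2) * δ := by
          gcongr
          nlinarith
        have h5 : V * Real.exp (2 * κ) * ((4 * κ + 2 * r + 1) * δ)
            ≤ V * (Real.exp (2 * κ) * (4 * κ + 2 * r + 2) * δ) := by
          rw [mul_assoc, mul_assoc (Real.exp (2 * κ))]
          gcongr
          norm_num
        linarith
    _ = (Real.exp (2 * κ) * (4 * κ + 2 * r + 2) * A) * (‖f.U‖ *
        (1 + ‖f.layer2.B‖ * ‖f.layer2.A‖) * (1 + V) * W) * D⁻¹ := by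
        rw [hδ]
        ring
    _ ≤ f.stability τ * D⁻¹ := by
        unfold stability
        gcongr
        exact f.le_exp_expSize

end TwoLayer

/-- All features are put into one orthogonal sum. One-hot token vectors have norm one whatever the
alphabet size, so the squared norm is at most `1 + 4 + 4 ≤ 4 ^ 2`, and the factor `8` is `2 * 4`. -/
theorem exists_sample_features {α : Type*} [Fintype α] [DecidableEq α] {E F : Type*}
    [NormedAddCommGroup E] [InnerProductSpace ℝ E] [NormedAddCommGroup F] [InnerProductSpace ℝ F]
    (X : ℕ → α) {v : ℕ → E} {w : ℕ → F} (hv : ∀ i, ‖v i‖ ≤ 2) (hw : ∀ i, ‖w i‖ ≤ 2) {L l : ℕ}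
    (hL : 0 < L) (hl : 0 < l) :
    ∃ s : ℕ → ℕ, (∀ a, SampleClose L l s 8 fun j => if X j = a then (1 : ℝ) else 0) ∧
      SampleClose L l s 8 v ∧ SampleClose L l s 8 w := by
  let Φ : ℕ → WithLp 2 (EuclideanSpace ℝ α × WithLp 2 (E × F)) := fun i =>
    WithLp.toLp 2 (EuclideanSpace.single (X i) (1 : ℝ), WithLp.toLp 2 (v i, w i))
  have hΦ : ∀ i, ‖Φ i‖ ≤ 4 := fun i => by
    refine le_of_sq_le_sq ?_ (by norm_num)
    rw [WithLp.prod_norm_sq_eq_of_L2]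
    have h1 : ‖(Φ i).fst‖ ^ 2 = 1 := by simp [Φ]
    have h2 : ‖(Φ i).snd‖ ^ 2 = ‖v i‖ ^ 2 + ‖w i‖ ^ 2 := WithLp.prod_norm_sq_eq_of_L2 _
    have h3 : ‖v i‖ ^ 2 ≤ 2 ^ 2 := by gcongr; exact hv i
    have h4 : ‖w i‖ ^ 2 ≤ 2 ^ 2 := by gcongr; exact hw i
    linarith
  obtain ⟨s, hs⟩ := exists_sample Φ hΦ hL hl
  have hs' : SampleClose L l s 8 Φ := fun m => (hs m).trans (by norm_num)
  have hfst := hs'.map (WithLp.fstL 2 ℝ (EuclideanSpace ℝ α) (WithLp 2 (E × F))).toLinearMap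
    fun x => WithLp.norm_fst_le _ x
  have hsnd := hs'.map (WithLp.sndL 2 ℝ (EuclideanSpace ℝ α) (WithLp 2 (E × F))).toLinearMap
    fun x => WithLp.norm_snd_le _ x
  refine ⟨s, fun a => ?_, hsnd.map (WithLp.fstL 2 ℝ E F).toLinearMap
    fun x => WithLp.norm_fst_le _ x, hsnd.map (WithLp.sndL 2 ℝ E F).toLinearMap
    fun x => WithLp.norm_snd_le _ x⟩
  have h := hfst.map (EuclideanSpace.proj (𝕜 := ℝ) a).toLinearMap
    fun x => PiLp.norm_apply_le x a
  convert h using 2 with j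
  simp [Φ, eq_comm]

/-! ### Complexity polynomials and choice of parameters -/

/-- The polynomial in the exponent of the complexity. -/
def expPoly : MvPolynomial (Fin 6) ℕ :=
  13 * ((1 + .X 0) * (1 + .X 3 * .X 2) + .X 3 * .X 4 + .X 5 + .X 1) ^ 3

/-- The polynomial factor of the complexity. -/
def factorPoly : MvPolynomial (Fin 6) ℕ :=
  .X 3 * (1 + .X 2 * .X 1) * (1 + .X 0) * (100 * (.X 4 + 1 + .X 5)) * (.X 4 + 1)

/-- The extra factor `τ + 1` beyond the stability constant settles the case `D < τ + 1`, where the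
stability constant is then at most `ε`. -/
theorem TwoLayer.complexity_eq {α : Type*} [Fintype α] {H d m : ℕ} (τ : ℕ)
    (f : TwoLayer α H d m) :
    f.complexity expPoly factorPoly τ = f.stability τ * (τ + 1) := by
  simp only [complexity, stability, expPoly, factorPoly, expSize, radius, map_mul, map_add,
    map_pow, map_one, map_ofNat, MvPolynomial.aeval_X]
  simp
  ring

/-- The extension of a nonempty finite sequence by its last entry. -/
def extend {α : Type*} {n : ℕ} (x : Fin (n + 1) → α) (i : ℕ) : α :=
  x ⟨min i n, by omega⟩

theorem extend_apply {α : Type*} {n : ℕ} (x : Fin (n + 1) → α) :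
    (fun i : Fin (n + 1) => extend x i) = x := by
  funext i
  unfold extend
  congr
  exact Nat.min_eq_left (by omega)

/-- The compressed length is at least `D ^ e`, so `β = e⁻¹` gives the rate `D⁻¹`. The bound `e ≥ 3`
gives `D ≤ D ^ (e - 2)`, the lower bound on the block length. -/
theorem compression_of_lt {τ N : ℕ} {D e : ℝ} (he : 3 ≤ e) (hD : τ + 1 ≤ D)
    (hN : ⌈D ^ 2⌉₊ * ⌈D ^ (e - 2)⌉₊ + τ + 1 ≤ N) :
    Compression τ ⌈D ^ 2⌉₊ ⌈D ^ (e - 2)⌉₊ (N / ⌈D ^ 2⌉₊) (N % ⌈D ^ 2⌉₊) D e⁻¹ := by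
  have hD1 : 1 ≤ D := le_trans (by simp) hD
  have hD0 : 0 < D := one_pos.trans_le hD1
  have hn : 0 < ⌈D ^ 2⌉₊ := Nat.ceil_pos.2 (by positivity)
  have hpow : D ^ e = D ^ 2 * D ^ (e - 2) := by
    rw [← Real.rpow_natCast D 2, ← Real.rpow_add hD0]
    congr 1
    push_cast
    ring
  refine ⟨hD, Nat.le_ceil _, ?_, ?_, Nat.mod_lt _ hn, ?_, ?_, by positivity, ?_⟩
  · refine le_trans ?_ (Nat.le_ceil _)
    calc D = D ^ (1 : ℝ) := (Real.rpow_one D).symm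
      _ ≤ D ^ (e - 2) := Real.rpow_le_rpow_of_exponent_le hD1 (by linarith)
  · rw [Nat.le_div_iff_mul_le hn, mul_comm]
    omega
  · rwa [Nat.div_add_mod N]
  · have h1 : D ^ e ≤ ((⌈D ^ 2⌉₊ * ⌈D ^ (e - 2)⌉₊ + τ + 1 : ℕ) : ℝ) := by
      push_cast
      have h2 : D ^ 2 * D ^ (e - 2) ≤ (⌈D ^ 2⌉₊ : ℝ) * ⌈D ^ (e - 2)⌉₊ := by
        gcongr <;> exact Nat.le_ceil _
      have h3 : (0 : ℝ) ≤ τ := by positivity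
      rw [hpow]
      linarith
    calc _ ≤ (D ^ e) ^ (-e⁻¹) := Real.rpow_le_rpow_of_nonpos (by positivity) h1
          (neg_nonpos.2 (by positivity))
      _ = D⁻¹ := by
        rw [← Real.rpow_mul hD0.le, mul_neg, mul_inv_cancel₀ (by linarith), Real.rpow_neg_one]
  · rw [← one_div]
    exact one_div_le_one_div_of_le (by norm_num) (by linarith)

theorem length_le {τ : ℕ} {D e : ℝ} (he : 3 ≤ e) (hD : τ + 1 ≤ D) :
    ((⌈D ^ 2⌉₊ * ⌈D ^ (e - 2)⌉₊ + τ + 1 : ℕ) : ℝ) ≤ 5 * D ^ e := by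
  have hD1 : 1 ≤ D := le_trans (by simp) hD
  have hD0 : 0 < D := one_pos.trans_le hD1
  have hpow : D ^ e = D ^ 2 * D ^ (e - 2) := by
    rw [← Real.rpow_natCast D 2, ← Real.rpow_add hD0]
    congr 1
    push_cast
    ring
  have hceil : ∀ t : ℝ, 1 ≤ t → (⌈t⌉₊ : ℝ) ≤ 2 * t := fun t ht => by
    have := Nat.ceil_lt_add_one (zero_le_one.trans ht)
    linarith
  have h1 := hceil (D ^ 2) (one_le_pow₀ hD1)
  have h2 := hceil (D ^ (e - 2)) (Real.one_le_rpow hD1 (by linarith))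
  have h3 : D ≤ D ^ e := by
    calc D = D ^ (1 : ℝ) := (Real.rpow_one D).symm
      _ ≤ D ^ e := Real.rpow_le_rpow_of_exponent_le hD1 (by linarith)
  push_cast
  calc (⌈D ^ 2⌉₊ : ℝ) * ⌈D ^ (e - 2)⌉₊ + τ + 1
      ≤ 2 * D ^ 2 * (2 * D ^ (e - 2)) + D ^ e := by
        rw [add_assoc]
        gcongr
        linarith
    _ = _ := by rw [hpow]; ring

theorem norm_sub_le_three_mul {E : Type*} [NormedAddCommGroup E] {a a' b b' : E} {ε : ℝ}
    (h1 : ‖a - a'‖ ≤ ε) (h2 : ‖a' - b'‖ ≤ ε) (h3 : ‖b - b'‖ ≤ ε) : ‖a - b‖ ≤ 3 * ε := by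
  rw [norm_sub_rev b] at h3
  have h4 := norm_sub_le_norm_sub_add_norm_sub a a' b
  have h5 := norm_sub_le_norm_sub_add_norm_sub a' b' b
  linarith

namespace TwoLayer

variable {α : Type*} [Fintype α] {Hf Hg df dg m τ : ℕ} {f : TwoLayer α Hf df m}
  {g : TwoLayer α Hg dg m} {ε : ℝ}

/-- For sequences longer than the compressed length, the outputs agree up to `stability / D` with
the outputs on a common compressed sequence. -/
theorem exists_short (hf : f.MemClass τ) (hg : g.MemClass τ) {D e : ℝ} (he : 3 ≤ e)
    (hef : ((f.margin τ)⁻¹).toReal ≤ e) (heg : ((g.margin τ)⁻¹).toReal ≤ e) (hD : τ + 1 ≤ D)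
    (X : ℕ → α) {N : ℕ} (hN : ⌈D ^ 2⌉₊ * ⌈D ^ (e - 2)⌉₊ + τ + 1 ≤ N + 1) :
    ∃ X' : ℕ → α,
      ‖f.evalNat X N - f.evalNat X' (⌈D ^ 2⌉₊ * ⌈D ^ (e - 2)⌉₊ + τ)‖ ≤ f.stability τ * D⁻¹ ∧
      ‖g.evalNat X N - g.evalNat X' (⌈D ^ 2⌉₊ * ⌈D ^ (e - 2)⌉₊ + τ)‖ ≤ g.stability τ * D⁻¹ := by
  classical
  have he0 : 0 < e := by linarith
  have he1 : e⁻¹ ≤ 1 := inv_le_one_of_one_le₀ (by linarith)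
  have C := compression_of_lt he hD hN
  obtain ⟨s, hs, hsf, hsg⟩ := exists_sample_features X (norm_feature_le hf X N)
    (norm_feature_le hg X N) C.L_pos C.l_pos
  have hT := Nat.div_add_mod (N + 1) ⌈D ^ 2⌉₊
  exact ⟨_, evalNat_sub_le_of_compression C hf
      (fun h => ⟨_, hf.posGap he1 (ofReal_inv_le_margin he0 hef) h⟩) hs hT hsf,
    evalNat_sub_le_of_compression C hg
      (fun h => ⟨_, hg.posGap he1 (ofReal_inv_le_margin he0 heg) h⟩) hs hT hsg⟩

end TwoLayer

end LimitTransformer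

end

/-! ### Conclusion -/

theorem theorem3 :
    ∃ (P R : MvPolynomial (Fin 6) ℕ) (c M : ℝ), 0 < c ∧ 0 < M ∧
      ∀ (α : Type*) [Fintype α] (τ Hf Hg df dg m : ℕ)
        (f : LimitTransformer.TwoLayer α Hf df m) (g : LimitTransformer.TwoLayer α Hg dg m),
        f.MemClass τ → g.MemClass τ →
        ∀ ε : ℝ, 0 < ε →
          ∃ N : ℕ,
            (N : ℝ) ≤ c * (max 1 (max (f.complexity P R τ) (g.complexity P R τ) * ε⁻¹)) ^
              (max (max ((f.margin τ)⁻¹).toReal ((g.margin τ)⁻¹).toReal) 3) ∧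
            ((∀ (n : ℕ) (x : Fin (n + 1) → α), n + 1 ≤ N → ‖f.eval x - g.eval x‖ ≤ ε) →
              ∀ (n : ℕ) (x : Fin (n + 1) → α), ‖f.eval x - g.eval x‖ ≤ M * ε) := by
  refine ⟨LimitTransformer.expPoly, LimitTransformer.factorPoly, 5, 3, by norm_num,
    by norm_num, ?_⟩
  intro α _ τ Hf Hg df dg m f g hf hg ε hε
  rw [f.complexity_eq, g.complexity_eq]
  set Cm := max (f.stability τ * (τ + 1)) (g.stability τ * (τ + 1))
  set e := max (max ((f.margin τ)⁻¹).toReal ((g.margin τ)⁻¹).toReal) 3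
  have he : 3 ≤ e := le_max_right _ _
  have hCf : f.stability τ * (τ + 1) ≤ Cm := le_max_left _ _
  have hCg : g.stability τ * (τ + 1) ≤ Cm := le_max_right _ _
  have hτ : (1 : ℝ) ≤ τ + 1 := by simp
  have eval_extend : ∀ (n : ℕ) (x : Fin (n + 1) → α),
      f.eval x = f.evalNat (LimitTransformer.extend x) n ∧
        g.eval x = g.evalNat (LimitTransformer.extend x) n := fun n x => by
    rw [← LimitTransformer.TwoLayer.eval_eq hf, ← LimitTransformer.TwoLayer.eval_eq hg,
      LimitTransformer.extend_apply]
    exact ⟨rfl, rfl⟩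
  by_cases hD : Cm * ε⁻¹ < τ + 1
  -- Here each output varies by at most `ε` over all inputs, so comparison with a single one-token
  -- sequence suffices.
  · refine ⟨1, ?_, fun h n x => ?_⟩
    · have := Real.one_le_rpow (le_max_left 1 (Cm * ε⁻¹)) (by linarith : 0 ≤ e)
      push_cast
      linarith
    · have hbound : ∀ K : ℝ, K * (τ + 1) ≤ Cm → K ≤ ε := fun K hK => by
        rw [← div_eq_mul_inv, div_lt_iff₀ hε] at hD
        nlinarith
      have h0 := h 0 (fun i : Fin (0 + 1) => LimitTransformer.extend x i) (by simp)
      rw [LimitTransformer.TwoLayer.eval_eq hf, LimitTransformer.TwoLayer.eval_eq hg] at h0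
      rw [(eval_extend n x).1, (eval_extend n x).2]
      exact LimitTransformer.norm_sub_le_three_mul
        ((LimitTransformer.TwoLayer.evalNat_sub_le_stability hf _ _ _ _).trans (hbound _ hCf)) h0
        ((LimitTransformer.TwoLayer.evalNat_sub_le_stability hg _ _ _ _).trans (hbound _ hCg))
  · rw [not_lt] at hD
    set D := Cm * ε⁻¹ with hDdef
    have hD1 : 1 ≤ D := hτ.trans hD
    refine ⟨⌈D ^ 2⌉₊ * ⌈D ^ (e - 2)⌉₊ + τ + 1, ?_, fun h n x => ?_⟩
    · rw [max_eq_right hD1]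
      exact LimitTransformer.length_le he hD
    · by_cases hn : n + 1 ≤ ⌈D ^ 2⌉₊ * ⌈D ^ (e - 2)⌉₊ + τ + 1
      · linarith [h n x hn]
      have hCm : 0 < Cm := by
        by_contra hneg
        have : D ≤ 0 := mul_nonpos_of_nonpos_of_nonneg (not_lt.1 hneg) (by positivity)
        linarith
      have hbound : ∀ K : ℝ, K * (τ + 1) ≤ Cm → K * D⁻¹ ≤ ε := fun K hK => by
        have hKC : K ≤ Cm := by
          by_cases hK0 : 0 ≤ K
          · nlinarith
          · linarith
        rw [← div_eq_mul_inv, div_le_iff₀ (by linarith), hDdef, mul_comm, mul_assoc,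
          inv_mul_cancel₀ hε.ne', mul_one]
        exact hKC
      obtain ⟨X', h1, h2⟩ := LimitTransformer.TwoLayer.exists_short hf hg he
        ((le_max_left _ _).trans (le_max_left _ _)) ((le_max_right _ _).trans (le_max_left _ _))
        hD (LimitTransformer.extend x) (N := n) (by omega)
      -- The compressed sequence has length exactly `N`, so the hypothesis just applies.
      have h0 := h _ (fun i : Fin (⌈D ^ 2⌉₊ * ⌈D ^ (e - 2)⌉₊ + τ + 1) => X' i) le_rfl
      rw [LimitTransformer.TwoLayer.eval_eq hf, LimitTransformer.TwoLayer.eval_eq hg] at h0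
      rw [(eval_extend n x).1, (eval_extend n x).2]
      exact LimitTransformer.norm_sub_le_three_mul (h1.trans (hbound _ hCf)) h0
        (h2.trans (hbound _ hCg))
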